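/- Let $\Gamma$ be a simplicial graph (an arbitrary simple graph, possibly infinite) with vertex set $V$, and let $A_\Gamma=\langle V \mid [v,w]=1 \text{ whenever } \{v,w\} \text{ is an edge of } \Gamma\rangle$ be its right-angled Artin group. Let $X_\Gamma$ be its standard cube complex (the universal cover of the Salvetti complex, which is the union of the tori given by the finite cliques of $\Gamma$): the vertices of $X_\Gamma$ are the elements of $A_\Gamma$, and for every $g\in A_\Gamma$ and every finite clique $\{v_1,\dots,v_n\}$ of $\Gamma$ there is an $n$-cube with vertices $g v_1^{\varepsilon_1}\cdots v_n^{\varepsilon_n}$, $\varepsilon\in\{0,1\}^n$. The group $A_\Gamma$ acts on $X_\Gamma$ by left multiplication. A half-space $H$ of a CAT(0) cube complex is one of the two components of the complement of a hyperplane, regarded as a set of vertices; $\overline H$ is the opposite half-space, i.e. the complement of $H$. Half-spaces $H,H'$ are transverse if all of $H\cap H'$, $H\cap\overline{H'}$, $\overline H\cap H'$, $\overline H\cap\overline{H'}$ are non-empty. They are tightly nested if $H\subseteq H'$ or $H'\subseteq H$ and no half-space lies properly between them. Then $X_\Gamma$ is a CAT(0) cube complex (it is simply connected and all its vertex links are flag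 simplicial complexes), and the action of $A_\Gamma$ on $X_\Gamma$ is an action by automorphisms which is RAAG-like, that is: (0) (no inversion) there are no half-space $H$ and $g\in A_\Gamma$ with $gH=\overline H$; (i) there are no half-space $H$ and $g\in A_\Gamma$ with $H$ and $gH$ transverse; (ii) (no inter-osculation) there are no tightly nested half-spaces $H,H'$ and $g\in A_\Gamma$ with $H$ and $gH'$ transverse; (iii) (no self-osculation) there are no half-space $H$ and $g\in A_\Gamma$ with $H$ and $g\overline H$ tightly nested. -/

import Mathlib

open scoped Pointwise commutatorElement

universe u

/-! ### Combinatorial cube complexes -/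

/-- A face of the vertex set `{0,1}ⁿ` of the standard `n`-cube: some coordinates are fixed
(those `i` with `p i = some b`), the remaining ones are free. -/
def IsCubeFace {n : ℕ} (F : Set (Fin n → Bool)) : Prop :=
  ∃ p : Fin n → Option Bool, F = {ε | ∀ i b, p i = some b → ε i = b}

/-- A cube complex with vertex set `X` in which every cube is embedded and determined by its
set of vertices (as is the case for every CAT(0) cube complex). It is recorded by the collection
of the vertex sets of its cubes. Each cube is a copy of a standard cube, and the cubes contained
in it are exactly its faces. -/
structure CubeComplex (X : Type u) where
  /-- The vertex sets of the cubes. -/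
  cubes : Set (Set X)
  vertex_mem : ∀ x : X, {x} ∈ cubes
  exists_chart : ∀ C ∈ cubes, ∃ (n : ℕ) (φ : (Fin n → Bool) → X),
    Function.Injective φ ∧ Set.range φ = C ∧
      ∀ D ⊆ C, D ∈ cubes ↔ ∃ F, IsCubeFace F ∧ D = φ '' F

namespace CubeComplex

variable {X : Type u} (K : CubeComplex X)

/-- The 1-skeleton: its edges are the 1-dimensional cubes. -/
def skeleton : SimpleGraph X where
  Adj x y := x ≠ y ∧ {x, y} ∈ K.cubes
  symm := ⟨fun x y h => ⟨h.1.symm, by rw [Set.pair_comm]; exact h.2⟩⟩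
  loopless := ⟨fun _ h => h.1 rfl⟩

/-- `a, b, d, c` are, in this cyclic order, the four vertices of a 2-dimensional cube, so that
`ab` and `cd` are opposite edges, and so are `ac` and `bd`. -/
def IsSquare (a b c d : X) : Prop :=
  {a, b, c, d} ∈ K.cubes ∧ a ≠ d ∧ b ≠ c ∧
    K.skeleton.Adj a b ∧ K.skeleton.Adj c d ∧ K.skeleton.Adj a c ∧ K.skeleton.Adj b d

/-- Two edges are opposite edges of some square. -/
def Opposite (e e' : Sym2 X) : Prop :=
  ∃ a b c d, K.IsSquare a b c d ∧ e = s(a, b) ∧ e' = s(c, d)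

/-- Hyperplanes. A hyperplane is a connected union of midcubes meeting each cube in the empty set
or in a single midcube; it is recorded by the set of the edges that it crosses (the edges dual to
it), which is a class of the equivalence relation generated by being opposite in a square. -/
def IsHyperplane (h : Set (Sym2 X)) : Prop :=
  ∃ e ∈ K.skeleton.edgeSet, h = {e' | Relation.EqvGen K.Opposite e e'}

/-- Half-spaces, recorded by their sets of vertices: `H` is a component of the complement of a
hyperplane. In a CAT(0) cube complex a hyperplane has exactly two complementary components, so
the opposite half-space `H̄` is the complement `Hᶜ`, and inclusion of half-spaces is inclusion of
their vertex sets. -/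
def IsHalfSpace (H : Set X) : Prop :=
  ∃ h, K.IsHyperplane h ∧
    ∃ c : (K.skeleton.deleteEdges h).ConnectedComponent, H = c.supp

/-- Two half-spaces are transverse if all four intersections are non-empty. -/
def Transverse (H H' : Set X) : Prop :=
  (H ∩ H').Nonempty ∧ (H ∩ H'ᶜ).Nonempty ∧ (Hᶜ ∩ H').Nonempty ∧ (Hᶜ ∩ H'ᶜ).Nonempty

/-- Two half-spaces are tightly nested if they are linearly ordered by inclusion and no half-space
lies properly between them. -/
def TightlyNested (H H' : Set X) : Prop :=
  (H ⊆ H' ∨ H' ⊆ H) ∧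
    ¬ ∃ L, K.IsHalfSpace L ∧ (H ⊂ L ∧ L ⊂ H' ∨ H' ⊂ L ∧ L ⊂ H)

/-- `C` is a cube at the vertex `x` and `S` is the set of the neighbours of `x` in `C`, that is,
`C` gives a simplex of the link of `x` with vertex set `S`. -/
def SpansAt (x : X) (S C : Set X) : Prop :=
  C ∈ K.cubes ∧ x ∈ C ∧ {y ∈ C | K.skeleton.Adj x y} = S

/-- Non-positive curvature (Gromov's link condition): the link of every vertex is a flag
simplicial complex, that is, every finite set of pairwise adjacent vertices of the link is the
vertex set of exactly one simplex. -/
def IsNonPositivelyCurved : Prop :=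
  ∀ (x : X) (S : Set X), S.Finite → (∀ y ∈ S, K.skeleton.Adj x y) →
    S.Pairwise (fun y z => ∃ C, K.SpansAt x {y, z} C) → ∃! C, K.SpansAt x S C

/-- Combinatorial homotopy of edge paths relative to their endpoints, generated by deleting
backtracks and by pushing a path across a square. -/
inductive Homotopic : ∀ {x y : X}, K.skeleton.Walk x y → K.skeleton.Walk x y → Prop
  | refl {x y : X} (p : K.skeleton.Walk x y) : Homotopic p p
  | symm {x y : X} {p q : K.skeleton.Walk x y} : Homotopic p q → Homotopic q p
  | trans {x y : X} {p q r : K.skeleton.Walk x y} :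
      Homotopic p q → Homotopic q r → Homotopic p r
  | cons {x y z : X} (h : K.skeleton.Adj x y) {p q : K.skeleton.Walk y z} :
      Homotopic p q → Homotopic (.cons h p) (.cons h q)
  | backtrack {x y z : X} (h : K.skeleton.Adj x y) (p : K.skeleton.Walk x z) :
      Homotopic (.cons h (.cons h.symm p)) p
  | square {a b c d z : X} (_ : K.IsSquare a b c d)
      (hab : K.skeleton.Adj a b) (hbd : K.skeleton.Adj b d)
      (hac : K.skeleton.Adj a c) (hcd : K.skeleton.Adj c d) (p : K.skeleton.Walk d z) :
      Homotopic (.cons hab (.cons hbd p)) (.cons hac (.cons hcd p))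

/-- Simple connectedness: the complex is connected (in particular non-empty) and every closed edge
path is null-homotopic. -/
def IsSimplyConnected : Prop :=
  K.skeleton.Connected ∧
    ∀ (x : X) (p : K.skeleton.Walk x x), K.Homotopic p SimpleGraph.Walk.nil

/-- A cube complex is CAT(0) if it is non-positively curved and simply connected. -/
def IsCAT0 : Prop := K.IsNonPositivelyCurved ∧ K.IsSimplyConnected

/-- An action of `G` on the vertices of a CAT(0) cube complex `K` that is an action by
automorphisms of `K` and is RAAG-like. -/
structure IsRAAGLike (G : Type*) [Group G] [MulAction G X] : Prop where
  cat0 : K.IsCAT0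
  /-- `G` acts by automorphisms of the cube complex. -/
  automorphism : ∀ (g : G), ∀ C ∈ K.cubes, g • C ∈ K.cubes
  /-- No element of `G` maps a half-space to the opposite half-space. -/
  without_inversion : ¬ ∃ (H : Set X) (g : G), K.IsHalfSpace H ∧ g • H = Hᶜ
  /-- No half-space is transverse to a translate of itself. -/
  not_transverse : ¬ ∃ (H : Set X) (g : G), K.IsHalfSpace H ∧ Transverse H (g • H)
  /-- There is no inter-osculation. -/
  no_inter_osculation : ¬ ∃ (H H' : Set X) (g : G), K.IsHalfSpace H ∧ K.IsHalfSpace H' ∧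
    K.TightlyNested H H' ∧ Transverse H (g • H')
  /-- There is no self-osculation. -/
  no_self_osculation : ¬ ∃ (H : Set X) (g : G), K.IsHalfSpace H ∧ K.TightlyNested H (g • Hᶜ)

end CubeComplex

/-! ### Right-angled Artin groups and their cube complexes -/

/-- The right-angled Artin group of `Γ`: generators are the vertices, relators are the commutators
`[v, w]` for the edges `{v, w}`. -/
abbrev RAAG {V : Type u} (Γ : SimpleGraph V) : Type u :=
  PresentedGroup {r : FreeGroup V | ∃ v w, Γ.Adj v w ∧ r = ⁅FreeGroup.of v, FreeGroup.of w⁆}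

namespace RAAG

variable {V : Type u} {Γ : SimpleGraph V}

/-- The generator of the right-angled Artin group given by a vertex of the graph. -/
def gen (Γ : SimpleGraph V) (v : V) : RAAG Γ := PresentedGroup.of v

/-- For `f = (v₁, …, vₙ)` the map `ε ↦ g v₁^ε₁ ⋯ vₙ^εₙ` on `{0,1}ⁿ`. -/
def cubeMap (g : RAAG Γ) {n : ℕ} (f : Fin n → V) (ε : Fin n → Bool) : RAAG Γ :=
  g * (List.ofFn fun i => if ε i then gen Γ (f i) else 1).prod

theorem gen_commute {v w : V} (h : Γ.Adj v w) : Commute (gen Γ v) (gen Γ w) := by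
  have : PresentedGroup.mk {r : FreeGroup V | ∃ v w, Γ.Adj v w ∧
      r = ⁅FreeGroup.of v, FreeGroup.of w⁆} ⁅FreeGroup.of v, FreeGroup.of w⁆ = 1 :=
    PresentedGroup.one_of_mem ⟨v, w, h, rfl⟩
  rw [map_commutatorElement] at this
  exact commutatorElement_eq_one_iff_commute.1 this

open Classical in
/-- The exponent sum of the generator `v`. -/
noncomputable def expSum (Γ : SimpleGraph V) (v : V) : RAAG Γ →* Multiplicative ℤ :=
  PresentedGroup.toGroup (f := fun w => if w = v then Multiplicative.ofAdd 1 else 1) (by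
    rintro r ⟨a, b, -, rfl⟩
    rw [map_commutatorElement]
    exact commutatorElement_eq_one_iff_commute.2 (Commute.all _ _))

open Classical in
theorem expSum_gen (v w : V) :
    expSum Γ v (gen Γ w) = if w = v then Multiplicative.ofAdd 1 else 1 :=
  PresentedGroup.toGroup.of _

theorem expSum_cubeMap (g : RAAG Γ) {n : ℕ} (f : Fin n → V) (hf : Function.Injective f)
    (ε : Fin n → Bool) (i : Fin n) :
    expSum Γ (f i) (cubeMap g f ε) =
      expSum Γ (f i) g * (if ε i then Multiplicative.ofAdd 1 else 1) := by
  classical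
  rw [cubeMap, map_mul, map_list_prod, List.map_ofFn, List.prod_ofFn]
  congr 1
  rw [Finset.prod_eq_single i]
  · by_cases h : ε i <;> simp [h, expSum_gen]
  · intro j _ hj
    by_cases h : ε j <;> simp [h, expSum_gen, hf.ne hj]
  · simp

theorem expSum_cubeMap_of_notMem (g : RAAG Γ) {n : ℕ} (f : Fin n → V) (ε : Fin n → Bool) (v : V)
    (hv : ∀ i, f i ≠ v) : expSum Γ v (cubeMap g f ε) = expSum Γ v g := by
  classical
  rw [cubeMap, map_mul, map_list_prod, List.map_ofFn, List.prod_ofFn, Finset.prod_eq_one, mul_one]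
  intro j _
  by_cases h : ε j <;> simp [h, expSum_gen, hv j]

theorem injective_of_adj {n : ℕ} {f : Fin n → V} (hf : ∀ i j, i ≠ j → Γ.Adj (f i) (f j)) :
    Function.Injective f := by
  intro i j hij
  by_contra h
  exact (hf i j h).ne hij

theorem cubeMap_injective (g : RAAG Γ) {n : ℕ} (f : Fin n → V) (hf : Function.Injective f) :
    Function.Injective (cubeMap g f) := by
  intro ε δ h
  funext i
  have := congrArg (expSum Γ (f i)) h
  rw [expSum_cubeMap g f hf, expSum_cubeMap g f hf] at this
  have h2 := congrArg Multiplicative.toAdd (mul_left_cancel this)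
  cases h3 : ε i <;> cases h4 : δ i <;> simp [h3, h4] at h2 ⊢

theorem commute_family {n : ℕ} {f : Fin n → V} (hf : ∀ i j, i ≠ j → Γ.Adj (f i) (f j)) :
    Pairwise fun i j => ∀ x y : Multiplicative ℤ,
      Commute (zpowersHom (RAAG Γ) (gen Γ (f i)) x) (zpowersHom (RAAG Γ) (gen Γ (f j)) y) := by
  intro i j hij x y
  simp only [zpowersHom_apply]
  exact ((gen_commute (hf i j hij)).zpow_left _).zpow_right _

theorem cubeMap_eq (g : RAAG Γ) {n : ℕ} {f : Fin n → V}
    (hf : ∀ i j, i ≠ j → Γ.Adj (f i) (f j)) (ε : Fin n → Bool) :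
    cubeMap g f ε = g * MonoidHom.noncommPiCoprod _ (commute_family hf)
      (fun i => if ε i then Multiplicative.ofAdd (1 : ℤ) else 1) := by
  rw [cubeMap]
  congr 1
  rw [MonoidHom.noncommPiCoprod_apply, List.ofFn_eq_map]
  have : ∀ i, zpowersHom (RAAG Γ) (gen Γ (f i)) (if ε i then Multiplicative.ofAdd (1 : ℤ) else 1) =
      if ε i then gen Γ (f i) else 1 := by
    intro i
    by_cases h : ε i <;> simp [h]
  simp only [this]
  exact (Multiset.noncommProd_coe _ _).symm

theorem cubeMap_face (g : RAAG Γ) {n m : ℕ} {f : Fin n → V}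
    (hf : ∀ i j, i ≠ j → Γ.Adj (f i) (f j)) (σ : Fin m → Fin n) (hσ : Function.Injective σ)
    (δ ε : Fin n → Bool) (ε' : Fin m → Bool) (h0 : ∀ j, δ (σ j) = false)
    (h1 : ∀ j, ε (σ j) = ε' j) (h2 : ∀ i, i ∉ Set.range σ → ε i = δ i) :
    cubeMap (cubeMap g f δ) (f ∘ σ) ε' = cubeMap g f ε := by
  have hf' : ∀ i j, i ≠ j → Γ.Adj ((f ∘ σ) i) ((f ∘ σ) j) := fun i j h => hf _ _ (hσ.ne h)
  have key : MonoidHom.noncommPiCoprod _ (commute_family hf') =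
      (MonoidHom.noncommPiCoprod _ (commute_family hf)).comp
        (Function.ExtendByOne.hom (Multiplicative ℤ) σ) := by
    refine MonoidHom.pi_ext fun j x => ?_
    rw [MonoidHom.comp_apply, MonoidHom.noncommPiCoprod_mulSingle]
    have : Function.ExtendByOne.hom (Multiplicative ℤ) σ (Pi.mulSingle j x) =
        Pi.mulSingle (σ j) x := by
      funext i
      by_cases hi : i ∈ Set.range σ
      · obtain ⟨k, rfl⟩ := hi
        by_cases hk : k = j
        · subst hk
          simp [Function.ExtendByOne.hom, hσ.extend_apply]
        · simp [Function.ExtendByOne.hom, hσ.extend_apply, Pi.mulSingle_eq_of_ne hk,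
            Pi.mulSingle_eq_of_ne (hσ.ne hk)]
      · have : i ≠ σ j := fun h => hi ⟨j, h.symm⟩
        simp [Function.ExtendByOne.hom, Function.extend_apply' _ _ _ hi,
          Pi.mulSingle_eq_of_ne this]
    rw [this, MonoidHom.noncommPiCoprod_mulSingle]
    rfl
  rw [cubeMap_eq _ hf', cubeMap_eq g hf, cubeMap_eq g hf, key, MonoidHom.comp_apply, mul_assoc,
    ← map_mul]
  congr 2
  funext i
  by_cases hi : i ∈ Set.range σ
  · obtain ⟨j, rfl⟩ := hi
    simp [Function.ExtendByOne.hom, hσ.extend_apply, h0, h1]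
  · rw [h2 i hi]
    simp [Function.ExtendByOne.hom, Function.extend_apply' _ _ _ hi]

theorem cubeMap_false (g : RAAG Γ) {n : ℕ} (f : Fin n → V) : cubeMap g f (fun _ => false) = g := by
  simp [cubeMap]

theorem cubeMap_single (g : RAAG Γ) {n : ℕ} {f : Fin n → V}
    (hf : ∀ i j, i ≠ j → Γ.Adj (f i) (f j)) (i : Fin n) :
    expSum Γ (f i) (cubeMap g f (fun j => decide (j = i))) =
      expSum Γ (f i) g * Multiplicative.ofAdd 1 := by
  rw [expSum_cubeMap g f (injective_of_adj hf)]
  simp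

/-- The cube complex `X_Γ`, the universal cover of the Salvetti complex (the union of the tori
given by the cliques of `Γ`). Its vertices are the elements of the group, and for every `g` and
every clique `v₁, …, vₙ` there is a cube with vertices `g v₁^ε₁ ⋯ vₙ^εₙ`, `ε ∈ {0,1}ⁿ`. In
particular its 1-skeleton is the Cayley graph. The group acts by left multiplication. -/
def cubeComplex (Γ : SimpleGraph V) : CubeComplex (RAAG Γ) where
  cubes := {C | ∃ (g : RAAG Γ) (n : ℕ) (f : Fin n → V),
    (∀ i j, i ≠ j → Γ.Adj (f i) (f j)) ∧ C = Set.range (cubeMap g f)}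
  vertex_mem x := ⟨x, 0, Fin.elim0, fun i => i.elim0, by
    ext y
    constructor
    · rintro rfl
      exact ⟨fun _ => false, cubeMap_false _ _⟩
    · rintro ⟨ε, rfl⟩
      simp [cubeMap]⟩
  exists_chart := by
    rintro C ⟨g, n, f, hf, rfl⟩
    refine ⟨n, cubeMap g f, cubeMap_injective g f (injective_of_adj hf), rfl, ?_⟩
    intro D hD
    constructor
    · rintro ⟨g', m, f', hf', rfl⟩
      obtain ⟨δ, hδ⟩ := hD ⟨fun _ => false, cubeMap_false g' f'⟩
      have hex : ∀ j, ∃ i, f i = f' j ∧ δ i = false := by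
        intro j
        obtain ⟨ε, hε⟩ := hD ⟨fun k => decide (k = j), rfl⟩
        have h1 := cubeMap_single g' hf' j
        rw [← hε, ← hδ] at h1
        by_cases h : ∃ i, f i = f' j
        · obtain ⟨i, hi⟩ := h
          refine ⟨i, hi, ?_⟩
          rw [← hi, expSum_cubeMap g f (injective_of_adj hf),
            expSum_cubeMap g f (injective_of_adj hf), mul_assoc] at h1
          have h2 := congrArg Multiplicative.toAdd (mul_left_cancel h1)
          cases h3 : ε i <;> cases h4 : δ i <;> simp [h3, h4] at h2 ⊢
        · push Not at h
          rw [expSum_cubeMap_of_notMem g f ε _ h, expSum_cubeMap_of_notMem g f δ _ h] at h1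
          have h2 := congrArg Multiplicative.toAdd h1
          simp at h2
      choose σ hσ1 hσ2 using hex
      obtain rfl : f ∘ σ = f' := funext hσ1
      have hσ : Function.Injective σ := (injective_of_adj hf').of_comp
      classical
      refine ⟨_, ⟨fun i => if i ∈ Set.range σ then none else some (δ i), rfl⟩, ?_⟩
      ext y
      constructor
      · rintro ⟨ε', rfl⟩
        refine ⟨fun i => if h : ∃ j, σ j = i then ε' h.choose else δ i, ?_, ?_⟩
        · intro i b hb
          by_cases h : ∃ j, σ j = i
          · simp [h] at hb
          · simpa [h] using hb
        · rw [← hδ]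
          symm
          refine cubeMap_face g hf σ hσ δ _ ε' hσ2 ?_ ?_
          · intro j
            have h : ∃ j', σ j' = σ j := ⟨j, rfl⟩
            rw [dif_pos h, hσ h.choose_spec]
          · intro i hi
            exact dif_neg hi
      · rintro ⟨ε, hε, rfl⟩
        refine ⟨fun j => ε (σ j), ?_⟩
        rw [← hδ]
        refine cubeMap_face g hf σ hσ δ _ _ hσ2 (fun _ => rfl) ?_
        intro i hi
        exact hε i (δ i) (if_neg hi)
    · rintro ⟨F, ⟨p, rfl⟩, rfl⟩
      classical
      let e := Fintype.equivFin {i // p i = none}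
      let σ : Fin (Fintype.card {i // p i = none}) → Fin n := fun j => (e.symm j).1
      have hσ : Function.Injective σ := Subtype.val_injective.comp e.symm.injective
      have hr : ∀ i, i ∉ Set.range σ ↔ p i ≠ none := by
        intro i
        rw [not_iff_not]
        constructor
        · rintro ⟨j, rfl⟩
          exact (e.symm j).2
        · intro h
          exact ⟨e ⟨i, h⟩, by simp [σ]⟩
      have h0 : ∀ j, (p (σ j)).getD false = false := by
        intro j
        have : p (σ j) = none := (e.symm j).2
        rw [this]; rfl
      refine ⟨cubeMap g f (fun i => (p i).getD false), _, f ∘ σ,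
        fun i j h => hf _ _ (hσ.ne h), ?_⟩
      ext y
      constructor
      · rintro ⟨ε, hε, rfl⟩
        refine ⟨fun j => ε (σ j), ?_⟩
        refine cubeMap_face g hf σ hσ _ _ _ h0 (fun _ => rfl) ?_
        intro i hi
        obtain ⟨b, hb⟩ := Option.ne_none_iff_exists'.1 ((hr i).1 hi)
        rw [hε i b hb, hb]; rfl
      · rintro ⟨ε', rfl⟩
        refine ⟨fun i => if h : ∃ j, σ j = i then ε' h.choose else (p i).getD false, ?_, ?_⟩
        · intro i b hb
          have h : ¬ ∃ j, σ j = i := (hr i).2 (by simp [hb])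
          simp [h, hb]
        · symm
          refine cubeMap_face g hf σ hσ _ _ ε' h0 ?_ ?_
          · intro j
            have h : ∃ j', σ j' = σ j := ⟨j, rfl⟩
            rw [dif_pos h, hσ h.choose_spec]
          · intro i hi
            exact dif_neg hi

end RAAG

/-! Every edge of the complex joins `x` to `x * gen Γ v` for a unique generator `v` and in a unique
direction; exponent sums detect both, and left translation preserves both.

CAT(0). The vertices of the link of a vertex are the signed generators, and its simplices are the
cliques with a choice of signs; such a complex is flag because pairwise adjacent labels form a
clique. For simple connectedness the group acts on the homotopy classes of paths with a fixed end, a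
generator prepending an edge: backtracks make this a permutation and squares give the relations. A
path class is then the image of the trivial one under an element depending only on the endpoints
(`pathHom_walk`).

Half-spaces. The hyperplane of the edge from `k` to `k * gen Γ v` consists of the translates of that
edge along `k * u`, `u ∈ link Γ v`. A signed crossing number `wall`, again obtained from a group
action, takes the values 0 and 1 on its two sides. Hence a half-space has a label and a direction in
which it is left (`exists_of_mem_side_of_notMem`), shared by all its translates. This excludes
inversions.

Transverse half-spaces have adjacent labels (`adj_of_transverse`), so translates of one half-space
are never transverse. If distinct half-spaces `H ⊆ H'` are tightly nested, a shortest path from `H`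
to the complement of `H'` has length two (`exists_osculation`). Adjacent labels would let its two
edges be exchanged, which contradicts `H ⊆ H'`; equal labels with opposite directions would make it
backtrack. These exclude inter-osculation and self-osculation. -/

namespace RAAG

variable {V : Type u} {Γ : SimpleGraph V}

/-! ### Letters and exponents -/

/-- A generator or its inverse. -/
def letter (Γ : SimpleGraph V) (v : V) (ε : Bool) : RAAG Γ :=
  if ε then gen Γ v else (gen Γ v)⁻¹

@[simp] theorem letter_true (v : V) : letter Γ v true = gen Γ v := rfl

@[simp] theorem letter_false (v : V) : letter Γ v false = (gen Γ v)⁻¹ := rfl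

@[simp] theorem letter_inv (v : V) (ε : Bool) : (letter Γ v ε)⁻¹ = letter Γ v (!ε) := by
  cases ε <;> simp

@[simp] theorem mul_letter_mul_letter_not (x : RAAG Γ) (v : V) (ε : Bool) :
    x * letter Γ v ε * letter Γ v (!ε) = x := by
  rw [← letter_inv, mul_inv_cancel_right]

theorem letter_commute {v w : V} (h : Γ.Adj v w) (ε δ : Bool) :
    Commute (letter Γ v ε) (letter Γ w δ) := by
  have := gen_commute h
  cases ε <;> cases δ <;> simp [this]

theorem closure_range_gen (Γ : SimpleGraph V) :
    Subgroup.closure (Set.range (gen Γ)) = ⊤ :=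
  PresentedGroup.closure_range_of _

theorem induction_letter {P : RAAG Γ → Prop} (h1 : P 1)
    (hs : ∀ x v ε, P x → P (x * letter Γ v ε)) (x : RAAG Γ) : P x := by
  have hx : x ∈ Subgroup.closure (Set.range (gen Γ)) := by
    rw [closure_range_gen]; exact Subgroup.mem_top x
  induction hx using Subgroup.closure_induction_right with
  | one => exact h1
  | mul_right x _ y hy ih =>
    obtain ⟨v, rfl⟩ := hy
    exact hs x v true ih
  | mul_inv_cancel x _ y hy ih =>
    obtain ⟨v, rfl⟩ := hy
    exact hs x v false ih

/-- The exponent sum of `v`, as an integer. -/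
noncomputable def exponent (v : V) (x : RAAG Γ) : ℤ := (expSum Γ v x).toAdd

theorem exponent_mul (v : V) (x y : RAAG Γ) :
    exponent v (x * y) = exponent v x + exponent v y := by
  simp [exponent]

/-- The exponent of a letter. -/
def sign (ε : Bool) : ℤ := if ε then 1 else -1

theorem sign_ne_zero (ε : Bool) : sign ε ≠ 0 := by cases ε <;> simp [sign]

theorem sign_injective : Function.Injective sign := by
  intro a b h; cases a <;> cases b <;> simp [sign] at h ⊢

theorem sign_not (ε : Bool) : sign (!ε) = - sign ε := by cases ε <;> simp [sign]

open Classical in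
theorem exponent_letter (v w : V) (ε : Bool) :
    exponent v (letter Γ w ε) = if w = v then sign ε else 0 := by
  cases ε <;> by_cases h : w = v <;> simp [exponent, expSum_gen, h, sign]

theorem letter_ne_one (v : V) (ε : Bool) : letter Γ v ε ≠ 1 := by
  intro h
  have h1 := exponent_letter (Γ := Γ) v v ε
  rw [h] at h1
  simp only [exponent, map_one, toAdd_one, if_true] at h1
  exact sign_ne_zero ε h1.symm

theorem letter_injective {v w : V} {ε δ : Bool} (h : letter Γ v ε = letter Γ w δ) :
    v = w ∧ ε = δ := by
  have h1 := exponent_letter (Γ := Γ) v v ε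
  rw [h, exponent_letter, if_pos rfl] at h1
  split_ifs at h1 with h2
  · exact ⟨h2.symm, (sign_injective h1).symm⟩
  · exact absurd h1.symm (sign_ne_zero ε)

/-! ### Cubes based at an arbitrary vertex -/

section Cubes

variable {n : ℕ} {f : Fin n → V}

/-- The homomorphism from `ℤⁿ` given by a clique. -/
noncomputable def cliqueHom (hf : ∀ i j, i ≠ j → Γ.Adj (f i) (f j)) :
    (Fin n → Multiplicative ℤ) →* RAAG Γ :=
  MonoidHom.noncommPiCoprod _ (commute_family hf)

theorem cliqueHom_mulSingle (hf : ∀ i j, i ≠ j → Γ.Adj (f i) (f j)) (i : Fin n) (ε : Bool) :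
    cliqueHom hf (Pi.mulSingle i (Multiplicative.ofAdd (sign ε))) = letter Γ (f i) ε := by
  rw [cliqueHom, MonoidHom.noncommPiCoprod_mulSingle]
  cases ε <;> simp [sign]

theorem exponent_cliqueHom (hf : ∀ i j, i ≠ j → Γ.Adj (f i) (f j)) (i : Fin n)
    (a : Fin n → Multiplicative ℤ) : exponent (f i) (cliqueHom hf a) = (a i).toAdd := by
  have : (expSum Γ (f i)).comp (cliqueHom hf) = Pi.evalMonoidHom _ i := by
    refine MonoidHom.pi_ext fun j x => ?_
    rw [MonoidHom.comp_apply, cliqueHom, MonoidHom.noncommPiCoprod_mulSingle]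
    by_cases h : j = i
    · subst h
      simp [zpowersHom_apply, expSum_gen, ← ofAdd_zsmul]
    · simp [zpowersHom_apply, expSum_gen, (injective_of_adj hf).ne h,
        Pi.mulSingle_eq_of_ne (Ne.symm h)]
  exact congrArg Multiplicative.toAdd (DFunLike.congr_fun this a)

theorem cliqueHom_comp {m : ℕ} (hf : ∀ i j, i ≠ j → Γ.Adj (f i) (f j)) (σ : Fin m → Fin n)
    (hσ : Function.Injective σ) (hf' : ∀ i j, i ≠ j → Γ.Adj ((f ∘ σ) i) ((f ∘ σ) j)) :
    cliqueHom hf' = (cliqueHom hf).comp (Function.ExtendByOne.hom (Multiplicative ℤ) σ) := by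
  refine MonoidHom.pi_ext fun j x => ?_
  rw [MonoidHom.comp_apply, cliqueHom, cliqueHom, MonoidHom.noncommPiCoprod_mulSingle]
  have : Function.ExtendByOne.hom (Multiplicative ℤ) σ (Pi.mulSingle j x) =
      Pi.mulSingle (σ j) x := by
    funext i
    by_cases hi : i ∈ Set.range σ
    · obtain ⟨k, rfl⟩ := hi
      by_cases hk : k = j
      · subst hk
        simp [Function.ExtendByOne.hom, hσ.extend_apply]
      · simp [Function.ExtendByOne.hom, hσ.extend_apply, Pi.mulSingle_eq_of_ne hk,
          Pi.mulSingle_eq_of_ne (hσ.ne hk)]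
    · have : i ≠ σ j := fun h => hi ⟨j, h.symm⟩
      simp [Function.ExtendByOne.hom, Function.extend_apply' _ _ _ hi,
        Pi.mulSingle_eq_of_ne this]
  rw [this, MonoidHom.noncommPiCoprod_mulSingle]
  rfl

/-- The cube at `x` spanned by the letters given by a clique `f` and signs `δ`. -/
noncomputable def cubeAt (x : RAAG Γ) (hf : ∀ i j, i ≠ j → Γ.Adj (f i) (f j)) (δ ε : Fin n → Bool) :
    RAAG Γ :=
  x * cliqueHom hf (fun i => if ε i then Multiplicative.ofAdd (sign (δ i)) else 1)

/-- Seen from the corner `α`, direction `i` is positive exactly when `α i` is false, so rebasing the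
cube there adds `α` to the coordinates modulo 2. -/
theorem cubeAt_cubeMap (g : RAAG Γ) (hf : ∀ i j, i ≠ j → Γ.Adj (f i) (f j))
    (α ε : Fin n → Bool) :
    cubeAt (cubeMap g f α) hf (fun i => !α i) ε = cubeMap g f (fun i => ε i ^^ α i) := by
  rw [cubeAt, cubeMap_eq g hf, cubeMap_eq g hf, mul_assoc]
  change g * (cliqueHom hf _ * _) = g * cliqueHom hf _
  rw [← map_mul]
  congr 2
  funext i
  cases h : α i <;> cases h' : ε i <;> simp [h, h', sign]

theorem range_cubeAt_cubeMap (g : RAAG Γ) (hf : ∀ i j, i ≠ j → Γ.Adj (f i) (f j))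
    (α : Fin n → Bool) :
    Set.range (cubeAt (cubeMap g f α) hf (fun i => !α i)) = Set.range (cubeMap g f) := by
  ext y
  constructor
  · rintro ⟨ε, rfl⟩
    exact ⟨_, (cubeAt_cubeMap g hf α ε).symm⟩
  · rintro ⟨ε, rfl⟩
    refine ⟨fun i => ε i ^^ α i, ?_⟩
    rw [cubeAt_cubeMap]
    simp

theorem range_cubeAt_mem (x : RAAG Γ) (hf : ∀ i j, i ≠ j → Γ.Adj (f i) (f j))
    (δ : Fin n → Bool) : Set.range (cubeAt x hf δ) ∈ (cubeComplex Γ).cubes := by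
  -- The lowest corner of the cube: step back along the directions with `δ i = false`, in which `x`
  -- is at the top.
  let g : RAAG Γ := x * (cliqueHom hf
      (fun i => if !δ i then Multiplicative.ofAdd (1 : ℤ) else 1))⁻¹
  have hg : cubeMap g f (fun i => !δ i) = x := by
    rw [cubeMap_eq g hf]
    exact inv_mul_cancel_right _ _
  refine ⟨g, n, f, hf, ?_⟩
  rw [← range_cubeAt_cubeMap g hf (fun i => !δ i), hg]
  simp

theorem exists_cubeAt {C : Set (RAAG Γ)} (hC : C ∈ (cubeComplex Γ).cubes) {x : RAAG Γ}
    (hx : x ∈ C) : ∃ (n : ℕ) (f : Fin n → V) (hf : ∀ i j, i ≠ j → Γ.Adj (f i) (f j))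
      (δ : Fin n → Bool), C = Set.range (cubeAt x hf δ) := by
  obtain ⟨g, n, f, hf, rfl⟩ := hC
  obtain ⟨α, rfl⟩ := hx
  exact ⟨n, f, hf, _, (range_cubeAt_cubeMap g hf α).symm⟩

theorem cubeAt_zero (x : RAAG Γ) (hf : ∀ i j, i ≠ j → Γ.Adj (f i) (f j)) (δ : Fin n → Bool) :
    cubeAt x hf δ (fun _ => false) = x := by
  have : (fun i : Fin n => (1 : Multiplicative ℤ)) = 1 := rfl
  simp [cubeAt, this]

theorem cubeAt_single (x : RAAG Γ) (hf : ∀ i j, i ≠ j → Γ.Adj (f i) (f j)) (δ : Fin n → Bool)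
    (i : Fin n) : cubeAt x hf δ (fun j => decide (j = i)) = x * letter Γ (f i) (δ i) := by
  rw [cubeAt, ← cliqueHom_mulSingle hf]
  congr 2
  funext j
  by_cases h : j = i
  · subst h; simp
  · simp [h]

theorem exists_of_cubeAt_ne {x : RAAG Γ} {hf : ∀ i j, i ≠ j → Γ.Adj (f i) (f j)}
    {δ ε : Fin n → Bool} (h : cubeAt x hf δ ε ≠ x) : ∃ i, ε i = true := by
  by_contra hcon
  have : ε = fun _ => false := funext fun i => by simpa using fun h => hcon ⟨i, h⟩
  exact h (this ▸ cubeAt_zero x hf δ)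

theorem exponent_cubeAt (x : RAAG Γ) (hf : ∀ i j, i ≠ j → Γ.Adj (f i) (f j))
    (δ ε : Fin n → Bool) (i : Fin n) :
    exponent (f i) (cubeAt x hf δ ε) = exponent (f i) x + if ε i then sign (δ i) else 0 := by
  rw [cubeAt, exponent_mul, exponent_cliqueHom]
  cases ε i <;> simp

/-- An edge changes only the exponent of its own label. This is how labels and signs of edges inside
a cube are recovered below. -/
theorem eq_of_exponent_ne {x y : RAAG Γ} {v w : V} {ε : Bool} (h : y = x * letter Γ w ε)
    (hne : exponent v y ≠ exponent v x) : w = v ∧ exponent v y = exponent v x + sign ε := by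
  subst h
  rw [exponent_mul, exponent_letter] at *
  by_cases hw : w = v <;> simp_all

end Cubes

/-! ### The 1-skeleton and the squares -/

theorem pair_letter_mem (x : RAAG Γ) (v : V) (ε : Bool) :
    {x, x * letter Γ v ε} ∈ (cubeComplex Γ).cubes := by
  have hf : ∀ i j : Fin 1, i ≠ j → Γ.Adj ((fun _ => v) i) ((fun _ => v) j) :=
    fun i j h => absurd (Subsingleton.elim i j) h
  have := range_cubeAt_mem x hf (fun _ => ε)
  convert this using 1
  ext y
  constructor
  · rintro (rfl | rfl)
    · exact ⟨_, cubeAt_zero _ hf _⟩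
    · exact ⟨_, cubeAt_single _ hf _ 0⟩
  · rintro ⟨η, rfl⟩
    cases h : η 0
    · left
      have : η = fun _ => false := funext fun i => by rw [Subsingleton.elim i 0, h]
      rw [this, cubeAt_zero]
    · right
      rw [Set.mem_singleton_iff, ← cubeAt_single x hf (fun _ => ε) 0]
      congr 1
      funext i
      rw [Subsingleton.elim i 0, h]; rfl

theorem adj_iff {x y : RAAG Γ} :
    (cubeComplex Γ).skeleton.Adj x y ↔ ∃ v ε, y = x * letter Γ v ε := by
  constructor
  · rintro ⟨hne, hC⟩
    obtain ⟨n, f, hf, δ, h⟩ := exists_cubeAt hC (Set.mem_insert x _)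
    obtain ⟨ε, hε⟩ := h ▸ (show y ∈ ({x, y} : Set _) by simp)
    -- Since `y ≠ x`, the cube has a direction `i`, hence contains a letter neighbour of `x`; in a
    -- set of two elements this must be `y`.
    obtain ⟨i, -⟩ := exists_of_cubeAt_ne (fun h' => hne (h'.symm.trans hε))
    refine ⟨f i, δ i, ?_⟩
    have hi : x * letter Γ (f i) (δ i) ∈ ({x, y} : Set _) := h ▸ ⟨_, cubeAt_single x hf δ i⟩
    rcases hi with hi | hi
    · exact absurd (mul_eq_left.1 hi) (letter_ne_one _ _)
    · exact hi.symm
  · rintro ⟨v, ε, rfl⟩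
    exact ⟨fun h => letter_ne_one v ε (mul_eq_left.1 h.symm), pair_letter_mem x v ε⟩

theorem adj_letter (x : RAAG Γ) (v : V) (ε : Bool) :
    (cubeComplex Γ).skeleton.Adj x (x * letter Γ v ε) := adj_iff.2 ⟨v, ε, rfl⟩

theorem neighbours_cubeAt {n : ℕ} {f : Fin n → V} (x : RAAG Γ)
    (hf : ∀ i j, i ≠ j → Γ.Adj (f i) (f j)) (δ : Fin n → Bool) :
    {y ∈ Set.range (cubeAt x hf δ) | (cubeComplex Γ).skeleton.Adj x y} =
      Set.range fun i => x * letter Γ (f i) (δ i) := by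
  ext y
  constructor
  · rintro ⟨⟨ε, rfl⟩, h⟩
    obtain ⟨i, hi⟩ := exists_of_cubeAt_ne h.ne'
    refine ⟨i, ?_⟩
    obtain ⟨w, θ, hw⟩ := adj_iff.1 h
    have he := exponent_cubeAt x hf δ ε i
    rw [hi, if_pos rfl] at he
    obtain ⟨rfl, h2⟩ := eq_of_exponent_ne hw (v := f i) (by
      rw [he]; have := sign_ne_zero (δ i); omega)
    rw [he] at h2
    have := sign_injective (add_left_cancel h2)
    dsimp only
    rw [hw, this]
  · rintro ⟨i, rfl⟩
    exact ⟨⟨_, cubeAt_single x hf δ i⟩, adj_letter _ _ _⟩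

theorem isSquare_letter (x : RAAG Γ) {v w : V} (h : Γ.Adj v w) (ε δ : Bool) :
    (cubeComplex Γ).IsSquare x (x * letter Γ v ε) (x * letter Γ w δ)
      (x * letter Γ v ε * letter Γ w δ) := by
  have hc := letter_commute h ε δ
  let f : Fin 2 → V := ![v, w]
  let d : Fin 2 → Bool := ![ε, δ]
  have hf : ∀ i j : Fin 2, i ≠ j → Γ.Adj (f i) (f j) := by
    intro i j hij
    fin_cases i <;> fin_cases j <;> simp [f, h, h.symm] at hij ⊢
  have h11 : cubeAt x hf d (fun _ => true) = x * letter Γ v ε * letter Γ w δ := by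
    have h0 := cliqueHom_mulSingle hf 0 (d 0)
    have h1 := cliqueHom_mulSingle hf 1 (d 1)
    simp only [f, d, Matrix.cons_val_zero, Matrix.cons_val_one] at h0 h1
    rw [cubeAt, ← h0, ← h1, mul_assoc, ← map_mul]
    congr 2
    funext i
    fin_cases i <;> simp [d]
  have hrange : ({x, x * letter Γ v ε, x * letter Γ w δ, x * letter Γ v ε * letter Γ w δ} : Set _)
      = Set.range (cubeAt x hf d) := by
    have h00 := cubeAt_zero x hf d
    have h10 := cubeAt_single x hf d 0
    have h01 := cubeAt_single x hf d 1
    simp only [f, d, Matrix.cons_val_zero, Matrix.cons_val_one] at h00 h10 h01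
    ext y
    constructor
    · rintro (rfl | rfl | rfl | rfl)
      exacts [⟨_, h00⟩, ⟨_, h10⟩, ⟨_, h01⟩, ⟨_, h11⟩]
    · rintro ⟨η, rfl⟩
      have key : η = (fun _ => false) ∨ η = (fun j => decide (j = 0)) ∨
          η = (fun j => decide (j = 1)) ∨ η = fun _ => true := by
        revert η; decide
      rcases key with h | h | h | h <;> rw [h]
      exacts [.inl h00, .inr (.inl h10), .inr (.inr (.inl h01)), .inr (.inr (.inr h11))]
  refine ⟨?_, ?_, ?_, adj_letter _ _ _, ?_, adj_letter _ _ _, adj_letter _ _ _⟩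
  · rw [hrange]; exact range_cubeAt_mem x hf d
  · intro h'
    rw [mul_assoc, left_eq_mul, mul_eq_one_iff_eq_inv, letter_inv] at h'
    exact h.ne (letter_injective h').1
  · intro h'
    exact h.ne (letter_injective (mul_left_cancel h')).1
  · rw [mul_assoc, hc.eq, ← mul_assoc]
    exact adj_letter _ _ _

/-- As distinct letter neighbours of `a` in one cube, `b` and `c` have adjacent labels. Both of
their coordinates are switched on at `d`: otherwise the edge to `d` would undo the letter and return
to `a`. -/
theorem exists_letters_of_isSquare {a b c d : RAAG Γ} (h : (cubeComplex Γ).IsSquare a b c d) :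
    ∃ v ε w δ, Γ.Adj v w ∧ b = a * letter Γ v ε ∧ c = a * letter Γ w δ ∧
      d = a * letter Γ v ε * letter Γ w δ := by
  obtain ⟨hC, had, hbc, hab, hcd, hac, hbd⟩ := h
  obtain ⟨n, f, hf, δ, hr⟩ := exists_cubeAt hC (Set.mem_insert a _)
  have hN := neighbours_cubeAt a hf δ
  rw [← hr] at hN
  obtain ⟨i, hi⟩ : b ∈ Set.range fun i => a * letter Γ (f i) (δ i) := hN ▸ ⟨by simp, hab⟩
  obtain ⟨j, hj⟩ : c ∈ Set.range fun i => a * letter Γ (f i) (δ i) := hN ▸ ⟨by simp, hac⟩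
  obtain ⟨ε, hε⟩ : d ∈ Set.range (cubeAt a hf δ) := hr ▸ by simp
  dsimp only at hi hj
  have hij : i ≠ j := by rintro rfl; exact hbc (hi.symm.trans hj)
  have hadj := hf i j hij
  -- an edge from `a * letter` to `d` whose label returns would give `d = a`
  have aux : ∀ k y, a * letter Γ (f k) (δ k) = y → (cubeComplex Γ).skeleton.Adj y d →
      ε k = true := by
    intro k y hy hyd
    by_contra hk
    obtain ⟨w, θ, hw⟩ := adj_iff.1 hyd
    have h1 := exponent_cubeAt a hf δ ε k
    rw [hε, if_neg hk] at h1
    have h2 : exponent (f k) y = exponent (f k) a + sign (δ k) := by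
      rw [← hy, exponent_mul, exponent_letter, if_pos rfl]
    have h0 := sign_ne_zero (δ k)
    obtain ⟨rfl, h3⟩ := eq_of_exponent_ne hw (v := f k) (by omega)
    have h4 : sign θ = sign (!δ k) := by rw [sign_not]; omega
    rw [sign_injective h4, ← hy, mul_letter_mul_letter_not] at hw
    exact had hw.symm
  have hεj := aux j c hj hcd
  have hεi := aux i b hi hbd
  refine ⟨f i, δ i, f j, δ j, hadj, hi.symm, hj.symm, ?_⟩
  obtain ⟨w, θ, hw⟩ := adj_iff.1 hbd
  have h1 := exponent_cubeAt a hf δ ε j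
  rw [hε, hεj, if_pos rfl] at h1
  have h2 : exponent (f j) b = exponent (f j) a := by
    rw [← hi, exponent_mul, exponent_letter, if_neg hadj.ne, add_zero]
  have h0 := sign_ne_zero (δ j)
  obtain ⟨rfl, h3⟩ := eq_of_exponent_ne hw (v := f j) (by omega)
  rw [hi, hw]
  congr 2
  exact sign_injective (by omega)

/-! ### Non-positive curvature -/

/-- The neighbours of `x` determine labels and signs, so they embed the directions of the small cube
into those of the large one; the small cube is the face where the other coordinates vanish. Used
both ways, this shows that a simplex of the link spans only one cube. -/
theorem range_cubeAt_subset {n m : ℕ} {f : Fin n → V} {f' : Fin m → V} (x : RAAG Γ)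
    (hf : ∀ i j, i ≠ j → Γ.Adj (f i) (f j)) (hf' : ∀ i j, i ≠ j → Γ.Adj (f' i) (f' j))
    (δ : Fin n → Bool) (δ' : Fin m → Bool)
    (h : ∀ i, ∃ j, x * letter Γ (f j) (δ j) = x * letter Γ (f' i) (δ' i)) :
    Set.range (cubeAt x hf' δ') ⊆ Set.range (cubeAt x hf δ) := by
  choose σ hσ using h
  have h1 : f ∘ σ = f' := funext fun i => (letter_injective (mul_left_cancel (hσ i))).1
  have h2 : δ ∘ σ = δ' := funext fun i => (letter_injective (mul_left_cancel (hσ i))).2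
  subst h1 h2
  have hinj : Function.Injective σ := (injective_of_adj hf').of_comp
  rintro _ ⟨ε, rfl⟩
  classical
  refine ⟨fun i => if h : ∃ j, σ j = i then ε h.choose else false, ?_⟩
  rw [cubeAt, cubeAt, cliqueHom_comp hf σ hinj, MonoidHom.comp_apply]
  congr 2
  funext i
  by_cases hi : ∃ j, σ j = i
  · have hc := hi.choose_spec
    have hex : ∃ j', σ j' = σ hi.choose := ⟨_, rfl⟩
    have e2 : Function.ExtendByOne.hom (Multiplicative ℤ) σ (fun i =>
        if ε i = true then Multiplicative.ofAdd (sign ((δ ∘ σ) i)) else 1) (σ hi.choose) =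
        if ε hi.choose = true then Multiplicative.ofAdd (sign ((δ ∘ σ) hi.choose)) else 1 := by
      simp only [Function.ExtendByOne.hom, MonoidHom.coe_mk, OneHom.coe_mk]
      exact hinj.extend_apply _ _ _
    rw [hc] at e2
    rw [e2, dif_pos hi, Function.comp_apply, hc]
  · rw [dif_neg hi]
    simp only [Function.ExtendByOne.hom, MonoidHom.coe_mk, OneHom.coe_mk]
    rw [Function.extend_apply' _ _ _ hi]
    simp

/-- Distinct neighbours of `x` in a common cube carry adjacent labels; in particular `v` and its
inverse never span a square. So pairwise adjacency in the link yields a clique, and its signed cube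
spans `S`. -/
theorem isNonPositivelyCurved (Γ : SimpleGraph V) : (cubeComplex Γ).IsNonPositivelyCurved := by
  intro x S hfin hadj hpair
  have hadj' : ∀ y : S, ∃ l : V × Bool, x * letter Γ l.1 l.2 = y := by
    rintro ⟨y, hy⟩
    obtain ⟨v, ε, h⟩ := adj_iff.1 (hadj y hy)
    exact ⟨(v, ε), h.symm⟩
  choose l hl using hadj'
  obtain ⟨n, ⟨e⟩⟩ : ∃ n, Nonempty (Fin n ≃ S) := by
    have := hfin.to_subtype
    obtain ⟨n, ⟨e⟩⟩ := Finite.exists_equiv_fin S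
    exact ⟨n, ⟨e.symm⟩⟩
  have hf : ∀ i j, i ≠ j → Γ.Adj (l (e i)).1 (l (e j)).1 := by
    intro i j hij
    obtain ⟨C, hC, hx, hN⟩ := hpair (e i).2 (e j).2
      (fun h => hij (e.injective (Subtype.ext h)))
    obtain ⟨m, f, hf, δ, rfl⟩ := exists_cubeAt hC hx
    rw [neighbours_cubeAt] at hN
    obtain ⟨a, ha⟩ : (e i : RAAG Γ) ∈ Set.range fun i => x * letter Γ (f i) (δ i) :=
      hN ▸ by simp
    obtain ⟨b, hb⟩ : (e j : RAAG Γ) ∈ Set.range fun i => x * letter Γ (f i) (δ i) :=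
      hN ▸ by simp
    dsimp only at ha hb
    have hab : a ≠ b := by
      rintro rfl
      exact hij (e.injective (Subtype.ext (ha.symm.trans hb)))
    rw [← hl] at ha hb
    rw [← (letter_injective (mul_left_cancel ha)).1, ← (letter_injective (mul_left_cancel hb)).1]
    exact hf a b hab
  have hS : (Set.range fun i => x * letter Γ (l (e i)).1 (l (e i)).2) = S := by
    ext y
    simp only [hl]
    constructor
    · rintro ⟨i, rfl⟩
      exact (e i).2
    · intro hy
      exact ⟨e.symm ⟨y, hy⟩, by simp⟩
  refine ⟨Set.range (cubeAt x hf fun i => (l (e i)).2),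
    ⟨range_cubeAt_mem _ _ _, ⟨_, cubeAt_zero _ _ _⟩, (neighbours_cubeAt _ _ _).trans hS⟩, ?_⟩
  rintro C ⟨hC, hx, hN⟩
  obtain ⟨m, f, hf', δ, rfl⟩ := exists_cubeAt hC hx
  rw [neighbours_cubeAt, ← hS] at hN
  apply Set.Subset.antisymm
  · apply range_cubeAt_subset
    intro i
    exact hN.subset (Set.mem_range_self i)
  · apply range_cubeAt_subset
    intro i
    exact hN.symm.subset (Set.mem_range_self i)

theorem smul_cubes (g : RAAG Γ) {C : Set (RAAG Γ)} (hC : C ∈ (cubeComplex Γ).cubes) :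
    g • C ∈ (cubeComplex Γ).cubes := by
  obtain ⟨h, n, f, hf, rfl⟩ := hC
  refine ⟨g * h, n, f, hf, ?_⟩
  rw [← Set.image_smul, ← Set.range_comp]
  congr 1
  funext ε
  simp [cubeMap, mul_assoc]

end RAAG

/-! ### Homotopy classes of edge paths -/

namespace CubeComplex

variable {X : Type u} (K : CubeComplex X)

/-- Homotopy of edge paths as a setoid. -/
def homotopySetoid (x z : X) : Setoid (K.skeleton.Walk x z) :=
  ⟨K.Homotopic, ⟨.refl, .symm, .trans⟩⟩

/-- Homotopy classes of edge paths from `x` to `z`. -/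
def PathClass (x z : X) : Type u := Quotient (K.homotopySetoid x z)

variable {K}

/-- The class of a path. -/
def PathClass.mk {x z : X} (p : K.skeleton.Walk x z) : K.PathClass x z := Quotient.mk _ p

/-- Put an edge in front of a class of paths. -/
def PathClass.cons {x y z : X} (h : K.skeleton.Adj y x) : K.PathClass x z → K.PathClass y z :=
  Quotient.map' (SimpleGraph.Walk.cons h) fun _ _ hp => Homotopic.cons h hp

/-- The equality lives in the sigma type because going along an edge and back returns to `x` only up
to a propositional equality of group elements. -/
theorem PathClass.cons_cons {x x' y z : X} (hx : x' = x) (h' : K.skeleton.Adj x' y)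
    (h : K.skeleton.Adj y x) (q : K.PathClass x z) :
    (⟨x', (q.cons h).cons h'⟩ : Σ x, K.PathClass x z) = ⟨x, q⟩ := by
  subst hx
  congr 1
  induction q using Quotient.inductionOn
  exact Quotient.sound (Homotopic.backtrack h' _)

theorem PathClass.cons_square {a a' b c d z : X} (ha : a' = a) (hs : K.IsSquare a b c d)
    (hab : K.skeleton.Adj a b) (hbd : K.skeleton.Adj b d)
    (hac : K.skeleton.Adj a' c) (hcd : K.skeleton.Adj c d) (q : K.PathClass d z) :
    (⟨a, (q.cons hbd).cons hab⟩ : Σ x, K.PathClass x z) = ⟨a', (q.cons hcd).cons hac⟩ := by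
  subst ha
  congr 1
  induction q using Quotient.inductionOn
  exact Quotient.sound (Homotopic.square hs _ _ _ _ _)

end CubeComplex

/-! ### Simple connectedness -/

namespace RAAG

open CubeComplex

variable {V : Type u} {Γ : SimpleGraph V}

theorem skeleton_connected (Γ : SimpleGraph V) : (cubeComplex Γ).skeleton.Connected := by
  have h : ∀ x, (cubeComplex Γ).skeleton.Reachable 1 x := fun x => by
    induction x using induction_letter with
    | h1 => rfl
    | hs x v ε ih => exact ih.trans (adj_letter x v ε).reachable
  have : Nonempty (RAAG Γ) := ⟨1⟩
  exact ⟨fun x y => (h x).symm.trans (h y)⟩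

theorem adj_letter_left (x : RAAG Γ) (v : V) (ε : Bool) :
    (cubeComplex Γ).skeleton.Adj (x * letter Γ v ε) x :=
  (adj_letter x v ε).symm

/-- The generator `v` acts on the classes of paths ending at `z` by putting an edge with label `v`
in front. -/
def pathPerm (z : RAAG Γ) (v : V) : Equiv.Perm (Σ x, (cubeComplex Γ).PathClass x z) where
  toFun q := ⟨q.1 * letter Γ v false, q.2.cons (adj_letter_left _ _ _)⟩
  invFun q := ⟨q.1 * letter Γ v true, q.2.cons (adj_letter_left _ _ _)⟩
  left_inv q := PathClass.cons_cons (mul_letter_mul_letter_not q.1 v false) _ _ _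
  right_inv q := PathClass.cons_cons (mul_letter_mul_letter_not q.1 v true) _ _ _

/-- The two orders of prepending the edges run along the two sides of a square. -/
theorem pathPerm_commute (z : RAAG Γ) {v w : V} (h : Γ.Adj v w) :
    Commute (pathPerm z v) (pathPerm z w) := by
  ext1 ⟨x, q⟩
  have hc := letter_commute h false false
  have hx : x * letter Γ v false * letter Γ w false = x * letter Γ w false * letter Γ v false := by
    rw [mul_assoc, hc.eq, mul_assoc]
  refine PathClass.cons_square hx ?_ (adj_letter_left _ _ _) (adj_letter_left _ _ _)
    (adj_letter_left _ _ _) (adj_letter_left _ _ _) q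
  -- The square is based at the far corner, so that its fourth vertex is `x`, where the given path
  -- starts.
  have hs := isSquare_letter (x * letter Γ w false * letter Γ v false) h true true
  have hl : ∀ (y : RAAG Γ) a, y * letter Γ a false * letter Γ a true = y :=
    fun y a => mul_letter_mul_letter_not y a false
  rw [hl, hl, ← hx, hl, hx] at hs
  exact hs

/-- The action of the group on the classes of paths ending at `z`. -/
def pathHom (z : RAAG Γ) : RAAG Γ →* Equiv.Perm (Σ x, (cubeComplex Γ).PathClass x z) :=
  PresentedGroup.toGroup (f := pathPerm z) (by
    rintro r ⟨v, w, h, rfl⟩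
    rw [map_commutatorElement]
    simpa [commutatorElement_eq_one_iff_commute] using pathPerm_commute z h)

theorem pathHom_gen (z : RAAG Γ) (v : V) : pathHom z (gen Γ v) = pathPerm z v :=
  PresentedGroup.toGroup.of _

theorem pathHom_letter {x y z : RAAG Γ} {v : V} {ε : Bool} (hx : x = y * letter Γ v ε)
    (h : (cubeComplex Γ).skeleton.Adj y x) (q : (cubeComplex Γ).PathClass x z) :
    pathHom z (letter Γ v ε) ⟨x, q⟩ = ⟨y, q.cons h⟩ := by
  have hy : y = x * letter Γ v (!ε) := by rw [hx, mul_letter_mul_letter_not]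
  clear hx
  subst hy
  cases ε
  · rw [letter_false, map_inv, pathHom_gen]; rfl
  · rw [letter_true, pathHom_gen]; rfl

/-- Applying the letters of `p` from its end backwards rebuilds `p` edge by edge, whereas the group
element `x⁻¹ * z` does not depend on `p`. -/
theorem pathHom_walk {x z : RAAG Γ} (p : (cubeComplex Γ).skeleton.Walk x z) :
    pathHom z (x⁻¹ * z) ⟨z, .mk .nil⟩ = ⟨x, .mk p⟩ := by
  induction p with
  | nil => simp
  | @cons y x z h p ih =>
    obtain ⟨v, ε, hx⟩ := adj_iff.1 h
    have : y⁻¹ * z = letter Γ v ε * (x⁻¹ * z) := by rw [hx]; group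
    rw [this, map_mul, Equiv.Perm.mul_apply, ih, pathHom_letter hx h]
    rfl

theorem isSimplyConnected (Γ : SimpleGraph V) : (cubeComplex Γ).IsSimplyConnected := by
  refine ⟨skeleton_connected Γ, fun x p => ?_⟩
  have h := (pathHom_walk p).symm.trans (pathHom_walk .nil)
  exact Quotient.exact (eq_of_heq (Sigma.mk.inj h).2)

end RAAG

namespace RAAG

open CubeComplex

variable {V : Type u} {Γ : SimpleGraph V}

/-! ### Walls -/

/-- The subgroup generated by the neighbours of `v`. -/
def link (Γ : SimpleGraph V) (v : V) : Subgroup (RAAG Γ) :=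
  Subgroup.closure {x | ∃ w, Γ.Adj v w ∧ x = gen Γ w}

theorem letter_mem_link {v w : V} (h : Γ.Adj v w) (ε : Bool) : letter Γ w ε ∈ link Γ v := by
  have : gen Γ w ∈ link Γ v := Subgroup.subset_closure ⟨w, h, rfl⟩
  cases ε
  · exact inv_mem this
  · exact this

theorem link_induction {v : V} {P : RAAG Γ → Prop} (h1 : P 1)
    (hs : ∀ x ∈ link Γ v, ∀ w ε, Γ.Adj v w → P x → P (x * letter Γ w ε)) {x : RAAG Γ}
    (hx : x ∈ link Γ v) : P x := by
  induction hx using Subgroup.closure_induction_right with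
  | one => exact h1
  | mul_right x hx y hy ih =>
    obtain ⟨w, h, rfl⟩ := hy
    exact hs x hx w true h ih
  | mul_inv_cancel x hx y hy ih =>
    obtain ⟨w, h, rfl⟩ := hy
    exact hs x hx w false h ih

theorem commute_letter_of_mem_link {v : V} {x : RAAG Γ} (hx : x ∈ link Γ v) (ε : Bool) :
    Commute (letter Γ v ε) x := by
  refine link_induction (P := fun x => Commute (letter Γ v ε) x) (Commute.one_right _) ?_ hx
  intro x _ w δ h ih
  exact ih.mul_right (letter_commute h ε δ)

open Classical in
/-- The action of the generator `w` on the product of the group and `ℤ` whose second coordinate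
counts the crossings of the hyperplane through the edge from `1` to `v`. -/
noncomputable def wallPerm (v w : V) : Equiv.Perm (RAAG Γ × ℤ) where
  -- The first coordinate stands for the inverse of a vertex `x`, so appending `w` to `x`
  -- corresponds to `invFun`; this is why the forward map subtracts.
  toFun p := (gen Γ w * p.1, p.2 - if w = v ∧ (gen Γ w * p.1)⁻¹ ∈ link Γ v then 1 else 0)
  invFun p := ((gen Γ w)⁻¹ * p.1, p.2 + if w = v ∧ p.1⁻¹ ∈ link Γ v then 1 else 0)
  left_inv p := by simp
  right_inv p := by simp

theorem gen_mul_inv_mem_link {v w : V} (h : Γ.Adj v w) (x : RAAG Γ) :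
    (gen Γ w * x)⁻¹ ∈ link Γ v ↔ x⁻¹ ∈ link Γ v := by
  rw [mul_inv_rev]
  exact Subgroup.mul_mem_cancel_right _ (letter_mem_link h false)

/-- At most one of `a`, `b` equals `v`, and then the other lies in `link Γ v`, so it does not affect
the membership test that governs the count. -/
theorem wallPerm_commute (v : V) {a b : V} (h : Γ.Adj a b) :
    Commute (wallPerm (Γ := Γ) v a) (wallPerm v b) := by
  classical
  ext1 ⟨x, n⟩
  have hc : gen Γ a * (gen Γ b * x) = gen Γ b * (gen Γ a * x) := by
    rw [← mul_assoc, (gen_commute h).eq, mul_assoc]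
  refine Prod.ext hc ?_
  change n - (if b = v ∧ (gen Γ b * x)⁻¹ ∈ link Γ v then 1 else 0)
      - (if a = v ∧ (gen Γ a * (gen Γ b * x))⁻¹ ∈ link Γ v then 1 else 0) =
    n - (if a = v ∧ (gen Γ a * x)⁻¹ ∈ link Γ v then 1 else 0)
      - (if b = v ∧ (gen Γ b * (gen Γ a * x))⁻¹ ∈ link Γ v then 1 else 0)
  by_cases ha : a = v
  · subst ha
    rw [hc, gen_mul_inv_mem_link h (gen Γ a * x)]
    simp [h.ne']
  · by_cases hb : b = v
    · subst hb
      rw [← hc, gen_mul_inv_mem_link h.symm (gen Γ b * x)]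
      simp [h.ne]
    · simp [ha, hb]

/-- The action of the group on its product with `ℤ` that counts crossings of a hyperplane. -/
noncomputable def wallHom (v : V) : RAAG Γ →* Equiv.Perm (RAAG Γ × ℤ) :=
  PresentedGroup.toGroup (f := wallPerm v) (by
    rintro r ⟨a, b, h, rfl⟩
    rw [map_commutatorElement]
    simpa [commutatorElement_eq_one_iff_commute] using wallPerm_commute v h)

theorem wallHom_gen (v w : V) : wallHom v (gen Γ w) = wallPerm v w :=
  PresentedGroup.toGroup.of _

theorem wallHom_fst (v : V) (x : RAAG Γ) (p : RAAG Γ × ℤ) : (wallHom v x p).1 = x * p.1 := by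
  induction x using induction_letter generalizing p with
  | h1 => simp
  | hs x w ε ih =>
    rw [map_mul, Equiv.Perm.mul_apply, ih, mul_assoc]
    congr 1
    cases ε
    · rw [letter_false, map_inv, wallHom_gen]; rfl
    · rw [letter_true, wallHom_gen]; rfl

/-- The number of crossings, counted with signs, of the hyperplane through the edge from `1` to
`v` on the way from `1` to `x`. -/
noncomputable def wall (v : V) (x : RAAG Γ) : ℤ := (wallHom v x⁻¹ (1, 0)).2

@[simp] theorem wall_one (v : V) : wall v (1 : RAAG Γ) = 0 := by simp [wall]

open Classical in
theorem wall_mul_gen (v w : V) (x : RAAG Γ) :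
    wall v (x * gen Γ w) = wall v x + if w = v ∧ x ∈ link Γ v then 1 else 0 := by
  have h : (wallHom v x⁻¹ (1, 0)).1 = x⁻¹ := by rw [wallHom_fst, mul_one]
  rw [wall, mul_inv_rev, map_mul, Equiv.Perm.mul_apply, map_inv, wallHom_gen]
  change (wallHom v x⁻¹ (1, 0)).2 +
    (if w = v ∧ (wallHom v x⁻¹ (1, 0)).1⁻¹ ∈ link Γ v then 1 else 0) = _
  rw [h, inv_inv]
  rfl

theorem wall_mul_letter_of_ne {v w : V} (h : w ≠ v) (x : RAAG Γ) (ε : Bool) :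
    wall v (x * letter Γ w ε) = wall v x := by
  cases ε
  · have := wall_mul_gen v w (x * letter Γ w false)
    simp only [letter_false, inv_mul_cancel_right, h, false_and, if_false, add_zero] at this
    exact this.symm
  · simp [wall_mul_gen, h]

/-- A path with labels adjacent to `w` never uses the label `v`, so it crosses no hyperplane
labelled `v`. The case `w = v` is included. -/
theorem wall_mul_of_mem_link {v w : V} (hvw : ¬ Γ.Adj w v) (x : RAAG Γ) {u : RAAG Γ}
    (hu : u ∈ link Γ w) : wall v (x * u) = wall v x := by
  refine link_induction (P := fun u => wall v (x * u) = wall v x) (by simp) ?_ hu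
  intro u _ a ε ha ih
  rw [← mul_assoc, wall_mul_letter_of_ne (fun h : a = v => hvw (h ▸ ha)), ih]

theorem wall_of_mem_link {v : V} {u : RAAG Γ} (hu : u ∈ link Γ v) : wall v u = 0 := by
  have := wall_mul_of_mem_link (Γ.loopless.irrefl v) 1 hu
  rwa [one_mul, wall_one] at this

/-- Left multiplication by `u` stabilises the hyperplane, so the increments along every edge agree.
-/
theorem wall_mul_left_of_mem_link {v : V} {u : RAAG Γ} (hu : u ∈ link Γ v) (x : RAAG Γ) :
    wall v (u * x) = wall v x := by
  have hg : ∀ x w, wall v (u * (x * gen Γ w)) - wall v (u * x) =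
      wall v (x * gen Γ w) - wall v x := by
    intro x w
    rw [← mul_assoc, wall_mul_gen, wall_mul_gen, Subgroup.mul_mem_cancel_left _ hu]
    ring
  induction x using induction_letter with
  | h1 => rw [mul_one, wall_of_mem_link hu, wall_one]
  | hs x w ε ih =>
    cases ε
    · have := hg (x * (gen Γ w)⁻¹) w
      rw [inv_mul_cancel_right, ih] at this
      rw [letter_false]
      omega
    · have := hg x w
      rw [letter_true]
      omega

/-! ### Hyperplanes -/

/-- The set of the edges dual to the hyperplane through the edge from `k` to `k v`. -/
def dualEdges (k : RAAG Γ) (v : V) : Set (Sym2 (RAAG Γ)) :=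
  {e | ∃ u ∈ link Γ v, e = s(k * u, k * u * gen Γ v)}

theorem eq_of_sym2_eq {x y : RAAG Γ} {v w : V} (h : s(x, x * gen Γ v) = s(y, y * gen Γ w)) :
    x = y ∧ v = w := by
  rcases Sym2.eq_iff.1 h with ⟨rfl, h⟩ | ⟨rfl, h⟩
  · exact ⟨rfl, (letter_injective (ε := true) (δ := true) (mul_left_cancel h)).1⟩
  · rw [mul_assoc, mul_eq_left, mul_eq_one_iff_eq_inv] at h
    exact absurd (letter_injective (ε := true) (δ := false) h).2 (by simp)

theorem mem_dualEdges {k x : RAAG Γ} {v w : V} :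
    s(x, x * gen Γ w) ∈ dualEdges k v ↔ w = v ∧ k⁻¹ * x ∈ link Γ v := by
  constructor
  · rintro ⟨u, hu, h⟩
    obtain ⟨rfl, rfl⟩ := eq_of_sym2_eq h
    simpa using hu
  · rintro ⟨rfl, h⟩
    exact ⟨_, h, by simp⟩

theorem exists_gen_of_mem_edgeSet {e : Sym2 (RAAG Γ)} (he : e ∈ (cubeComplex Γ).skeleton.edgeSet) :
    ∃ k v, e = s(k, k * gen Γ v) := by
  induction e with
  | _ x y =>
    obtain ⟨v, ε, hy⟩ := adj_iff.1 he
    dsimp only at hy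
    subst hy
    cases ε
    · refine ⟨x * (gen Γ v)⁻¹, v, ?_⟩
      rw [inv_mul_cancel_right, Sym2.eq_swap]
      rfl
    · exact ⟨x, v, rfl⟩

theorem opposite_symm {e e' : Sym2 (RAAG Γ)} (h : (cubeComplex Γ).Opposite e e') :
    (cubeComplex Γ).Opposite e' e := by
  obtain ⟨a, b, c, d, ⟨hC, had, hbc, hab, hcd, hac, hbd⟩, rfl, rfl⟩ := h
  refine ⟨c, d, a, b, ⟨?_, hbc.symm, had.symm, hcd, hab, hac.symm, hbd.symm⟩, rfl, rfl⟩
  convert hC using 1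
  ext; simp; tauto

theorem opposite_mem_dualEdges {k : RAAG Γ} {v : V} {e e' : Sym2 (RAAG Γ)}
    (h : (cubeComplex Γ).Opposite e e') (he : e ∈ dualEdges k v) : e' ∈ dualEdges k v := by
  obtain ⟨a, b, c, d, hs, rfl, rfl⟩ := h
  obtain ⟨w, ε, w', δ, hadj, rfl, rfl, rfl⟩ := exists_letters_of_isSquare hs
  rw [mul_assoc a, (letter_commute hadj ε δ).eq, ← mul_assoc]
  have key : ∀ x, s(x, x * gen Γ w) ∈ dualEdges k v →
      s(x * letter Γ w' δ, x * letter Γ w' δ * gen Γ w) ∈ dualEdges k v := by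
    intro x hx
    rw [mem_dualEdges] at hx ⊢
    obtain ⟨rfl, hx⟩ := hx
    refine ⟨rfl, ?_⟩
    rw [← mul_assoc]
    exact mul_mem hx (letter_mem_link hadj δ)
  cases ε
  · have := key (a * (gen Γ w)⁻¹)
    rw [inv_mul_cancel_right, Sym2.eq_swap] at this
    have h2 := this he
    have hc := letter_commute hadj false δ
    rw [letter_false] at hc ⊢
    rw [mul_assoc a, hc.eq, ← mul_assoc, inv_mul_cancel_right, Sym2.eq_swap] at h2
    exact h2
  · exact key a he

/-- Crossing a square moves a dual edge by a letter commuting with `v`; conversely each letter of an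
element of the link gives such a square. -/
theorem eqvGen_opposite_iff (k : RAAG Γ) (v : V) (e : Sym2 (RAAG Γ)) :
    Relation.EqvGen (cubeComplex Γ).Opposite s(k, k * gen Γ v) e ↔ e ∈ dualEdges k v := by
  constructor
  · intro h
    have : ∀ a b, Relation.EqvGen (cubeComplex Γ).Opposite a b →
        (a ∈ dualEdges k v ↔ b ∈ dualEdges k v) := by
      intro a b hab
      induction hab with
      | rel a b h => exact ⟨opposite_mem_dualEdges h, opposite_mem_dualEdges (opposite_symm h)⟩
      | refl => rfl
      | symm _ _ _ ih => exact ih.symm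
      | trans _ _ _ _ _ ih₁ ih₂ => exact ih₁.trans ih₂
    refine (this _ _ h).1 (mem_dualEdges.2 ⟨rfl, ?_⟩)
    simp
  · rintro ⟨u, hu, rfl⟩
    refine link_induction (P := fun u => Relation.EqvGen (cubeComplex Γ).Opposite
      s(k, k * gen Γ v) s(k * u, k * u * gen Γ v)) ?_ ?_ hu
    · rw [mul_one]; exact .refl _
    · intro x _ w ε hw ih
      refine ih.trans _ _ _ (.rel _ _ ?_)
      have hs := isSquare_letter (k * x) hw true ε
      refine ⟨_, _, _, _, hs, rfl, ?_⟩
      rw [mul_assoc (k * x), (letter_commute hw true ε).eq]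
      simp [mul_assoc]

theorem isHyperplane_iff {h : Set (Sym2 (RAAG Γ))} :
    (cubeComplex Γ).IsHyperplane h ↔ ∃ k v, h = dualEdges k v := by
  constructor
  · rintro ⟨e, he, rfl⟩
    obtain ⟨k, v, rfl⟩ := exists_gen_of_mem_edgeSet he
    exact ⟨k, v, Set.ext fun e' => eqvGen_opposite_iff k v e'⟩
  · rintro ⟨k, v, rfl⟩
    exact ⟨s(k, k * gen Γ v), adj_letter k v true,
      (Set.ext fun e' => eqvGen_opposite_iff k v e').symm⟩

/-! ### Half-spaces -/

/-- A side of the hyperplane through the edge from `k` to `k v`: the one containing `k v` if `ε`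
is true, the one containing `k` otherwise. -/
def side (k : RAAG Γ) (v : V) (ε : Bool) : Set (RAAG Γ) :=
  {x | wall v (k⁻¹ * x) = if ε then 1 else 0}

theorem wall_eq_of_adj_deleteEdges {k x y : RAAG Γ} {v : V}
    (h : ((cubeComplex Γ).skeleton.deleteEdges (dualEdges k v)).Adj x y) :
    wall v (k⁻¹ * x) = wall v (k⁻¹ * y) := by
  obtain ⟨hadj, hn⟩ := SimpleGraph.deleteEdges_adj.1 h
  have key : ∀ x w, s(x, x * gen Γ w) ∉ dualEdges k v →
      wall v (k⁻¹ * (x * gen Γ w)) = wall v (k⁻¹ * x) := by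
    intro x w hx
    rw [← mul_assoc, wall_mul_gen, if_neg (fun h => hx (mem_dualEdges.2 h)), add_zero]
  obtain ⟨w, ε, rfl⟩ := adj_iff.1 hadj
  cases ε
  · have := key (x * (gen Γ w)⁻¹) w
    rw [inv_mul_cancel_right, Sym2.eq_swap] at this
    exact this hn
  · exact (key x w hn).symm

theorem wall_eq_of_reachable {k x y : RAAG Γ} {v : V}
    (h : ((cubeComplex Γ).skeleton.deleteEdges (dualEdges k v)).Reachable x y) :
    wall v (k⁻¹ * x) = wall v (k⁻¹ * y) := by
  obtain ⟨p⟩ := h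
  induction p with
  | nil => rfl
  | cons h _ ih => exact (wall_eq_of_adj_deleteEdges h).trans ih

theorem reachable_mul_of_mem_link {k : RAAG Γ} {v : V} (x : RAAG Γ) {u : RAAG Γ}
    (hu : u ∈ link Γ v) :
    ((cubeComplex Γ).skeleton.deleteEdges (dualEdges k v)).Reachable x (x * u) := by
  refine link_induction (P := fun u => ((cubeComplex Γ).skeleton.deleteEdges
    (dualEdges k v)).Reachable x (x * u)) (by simp) ?_ hu
  intro u _ w ε hw ih
  refine ih.trans (SimpleGraph.Adj.reachable ?_)
  rw [← mul_assoc, SimpleGraph.deleteEdges_adj]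
  refine ⟨adj_letter _ _ _, fun hmem => ?_⟩
  cases ε
  · have : s(x * u, x * u * letter Γ w false) =
        s(x * u * (gen Γ w)⁻¹, x * u * (gen Γ w)⁻¹ * gen Γ w) := by
      rw [inv_mul_cancel_right, Sym2.eq_swap]; rfl
    rw [this] at hmem
    exact hw.ne' (mem_dualEdges.1 hmem).1
  · exact hw.ne' (mem_dualEdges.1 hmem).1

/-- Follow a walk from `x` to `k`. When it uses a dual edge, the ends of that edge are joined to `k`
and to `k * gen Γ v` by paths along the link, which avoid the dual edges. -/
theorem reachable_or_reachable (k : RAAG Γ) (v : V) (x : RAAG Γ) :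
    ((cubeComplex Γ).skeleton.deleteEdges (dualEdges k v)).Reachable k x ∨
      ((cubeComplex Γ).skeleton.deleteEdges (dualEdges k v)).Reachable (k * gen Γ v) x := by
  obtain ⟨p⟩ := (skeleton_connected Γ).preconnected x k
  induction p with
  | nil => exact .inl .rfl
  | @cons x y z h p ih =>
    by_cases hmem : s(x, y) ∈ dualEdges z v
    · obtain ⟨u, hu, h⟩ := hmem
      rcases Sym2.eq_iff.1 h with ⟨rfl, -⟩ | ⟨rfl, -⟩
      · exact .inl (reachable_mul_of_mem_link z hu)
      · right
        have hc : Commute (gen Γ v) u := commute_letter_of_mem_link hu true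
        rw [mul_assoc, ← hc.eq, ← mul_assoc]
        exact reachable_mul_of_mem_link _ hu
    · have hr : ((cubeComplex Γ).skeleton.deleteEdges (dualEdges z v)).Reachable y x :=
        (SimpleGraph.deleteEdges_adj.2 ⟨h, hmem⟩).symm.reachable
      exact ih.imp (·.trans hr) (·.trans hr)

theorem wall_gen (v : V) : wall v (gen Γ v) = 1 := by
  have := wall_mul_gen v v (1 : RAAG Γ)
  simpa [one_mem] using this

/-- There are at most two components, and `wall`, constant on each, is 0 at `k` and 1 at `k * gen Γ
v`. -/
theorem side_eq_reachable (k : RAAG Γ) (v : V) (ε : Bool) :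
    side k v ε = {x | ((cubeComplex Γ).skeleton.deleteEdges (dualEdges k v)).Reachable
      (if ε then k * gen Γ v else k) x} := by
  ext x
  constructor
  · intro hx
    rcases reachable_or_reachable k v x with h | h
    · have h2 := wall_eq_of_reachable h
      rw [inv_mul_cancel, wall_one] at h2
      cases ε
      · simpa using h
      · simp [side, ← h2] at hx
    · have h2 := wall_eq_of_reachable h
      rw [inv_mul_cancel_left, wall_gen] at h2
      cases ε
      · simp [side, ← h2] at hx
      · simpa using h
  · intro h
    have h2 := wall_eq_of_reachable h
    cases ε <;> simpa [side, wall_gen] using h2.symm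

theorem side_not (k : RAAG Γ) (v : V) (ε : Bool) : side k v (!ε) = (side k v ε)ᶜ := by
  ext x
  have h : wall v (k⁻¹ * x) = 0 ∨ wall v (k⁻¹ * x) = 1 := by
    rcases reachable_or_reachable k v x with h | h
    · left; simpa using (wall_eq_of_reachable h).symm
    · right; simpa [wall_gen] using (wall_eq_of_reachable h).symm
  cases ε <;> rcases h with h | h <;> simp [side, h]

theorem isHalfSpace_iff {H : Set (RAAG Γ)} :
    (cubeComplex Γ).IsHalfSpace H ↔ ∃ k v ε, H = side k v ε := by
  constructor
  · rintro ⟨h, hh, c, rfl⟩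
    obtain ⟨k, v, rfl⟩ := isHyperplane_iff.1 hh
    induction c using SimpleGraph.ConnectedComponent.ind with
    | h x =>
      have key : ∀ ε : Bool, ((cubeComplex Γ).skeleton.deleteEdges (dualEdges k v)).Reachable
          (if ε then k * gen Γ v else k) x → ∃ k' v' ε', (SimpleGraph.connectedComponentMk
            ((cubeComplex Γ).skeleton.deleteEdges (dualEdges k v)) x).supp = side k' v' ε' := by
        intro ε hx
        refine ⟨k, v, ε, ?_⟩
        rw [side_eq_reachable]
        ext y
        rw [SimpleGraph.ConnectedComponent.mem_supp_iff, SimpleGraph.ConnectedComponent.eq]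
        exact ⟨fun h => hx.trans h.symm, fun h => h.symm.trans hx⟩
      exact (reachable_or_reachable k v x).elim (key false) (key true)
  · rintro ⟨k, v, ε, rfl⟩
    refine ⟨dualEdges k v, isHyperplane_iff.2 ⟨k, v, rfl⟩,
      SimpleGraph.connectedComponentMk _ (if ε then k * gen Γ v else k), ?_⟩
    rw [side_eq_reachable]
    ext y
    rw [SimpleGraph.ConnectedComponent.mem_supp_iff, SimpleGraph.ConnectedComponent.eq]
    exact ⟨SimpleGraph.Reachable.symm, SimpleGraph.Reachable.symm⟩

end RAAG

namespace RAAG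

open CubeComplex

variable {V : Type u} {Γ : SimpleGraph V}

/-! ### Nested half-spaces -/

theorem smul_side (g k : RAAG Γ) (v : V) (ε : Bool) : g • side k v ε = side (g * k) v ε := by
  ext x
  rw [Set.mem_smul_set_iff_inv_smul_mem]
  simp [side, mul_assoc]

/-- Only a dual edge changes `wall`. So the label and the direction of an edge leaving a half-space
depend on the half-space alone, and its start lies in one coset of the link. -/
theorem exists_of_mem_side_of_notMem {k x : RAAG Γ} {v w : V} {ε δ : Bool} (hx : x ∈ side k v ε)
    (hy : x * letter Γ w δ ∉ side k v ε) :
    w = v ∧ δ = !ε ∧ ∃ u ∈ link Γ v, x = (if ε then k * gen Γ v else k) * u := by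
  have hw : w = v := by
    by_contra hw
    apply hy
    rw [side, Set.mem_ofPred_eq] at hx ⊢
    rw [← mul_assoc, wall_mul_letter_of_ne hw, hx]
  subst hw
  refine ⟨rfl, ?_⟩
  simp only [side, Set.mem_ofPred_eq, ← mul_assoc] at hx hy
  cases δ
  · rw [letter_false] at hy
    have h := wall_mul_gen w w (k⁻¹ * x * (gen Γ w)⁻¹)
    rw [inv_mul_cancel_right] at h
    by_cases hl : k⁻¹ * x * (gen Γ w)⁻¹ ∈ link Γ w
    · rw [wall_of_mem_link hl, if_pos ⟨rfl, hl⟩, hx] at h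
      cases ε
      · simp at h
      · refine ⟨rfl, _, hl, ?_⟩
        have hc := commute_letter_of_mem_link hl true
        rw [letter_true] at hc
        simp only [if_true]
        rw [mul_assoc k, hc.eq]
        group
    · rw [if_neg (fun h => hl h.2), add_zero] at h
      exact absurd (h ▸ hx) hy
  · rw [letter_true, wall_mul_gen] at hy
    by_cases hl : k⁻¹ * x ∈ link Γ w
    · rw [wall_of_mem_link hl] at hx
      cases ε
      · exact ⟨rfl, _, hl, by simp⟩
      · simp at hx
    · rw [if_neg (fun h => hl h.2), add_zero] at hy
      exact absurd hx hy

theorem mul_letter_mem_side {k x : RAAG Γ} {v w : V} {ε δ : Bool} (hw : w ≠ v)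
    (hx : x ∈ side k v ε) : x * letter Γ w δ ∈ side k v ε := by
  by_contra h
  exact hw (exists_of_mem_side_of_notMem hx h).1

theorem exists_side_of_letter (x : RAAG Γ) (v : V) (ε : Bool) :
    ∃ k, x ∈ side k v (!ε) ∧ x * letter Γ v ε ∉ side k v (!ε) := by
  cases ε
  · exact ⟨x * (gen Γ v)⁻¹, by simp [side, wall_gen], by simp [side]⟩
  · exact ⟨x, by simp [side], by simp [side, wall_gen]⟩

theorem exists_mem_side (k : RAAG Γ) (v : V) (ε : Bool) :
    ∃ x ∈ side k v ε, x * letter Γ v (!ε) ∉ side k v ε := by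
  cases ε
  · exact ⟨k, by simp [side], by simp [side, wall_gen]⟩
  · exact ⟨k * gen Γ v, by simp [side, wall_gen], by simp [side]⟩

/-- An edge is dual to only one hyperplane: the two base points differ by an element of the link,
which `wall` does not see. -/
theorem side_eq_of_crossing {k k' x y : RAAG Γ} {v w : V} {ε δ : Bool}
    (h : (cubeComplex Γ).skeleton.Adj x y) (hx : x ∈ side k v ε) (hy : y ∉ side k v ε)
    (hx' : x ∈ side k' w δ) (hy' : y ∉ side k' w δ) : side k v ε = side k' w δ := by
  obtain ⟨a, θ, rfl⟩ := adj_iff.1 h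
  obtain ⟨rfl, rfl, u, hu, hxu⟩ := exists_of_mem_side_of_notMem hx hy
  obtain ⟨rfl, hε, u', hu', hxu'⟩ := exists_of_mem_side_of_notMem hx' hy'
  have : ε = δ := by simpa using hε
  subst this
  have hk : k' = k * (u * u'⁻¹) := by
    rw [← mul_assoc, eq_mul_inv_iff_mul_eq]
    have hh := hxu.symm.trans hxu'
    cases ε
    · simpa using hh.symm
    · have h1 := commute_letter_of_mem_link hu true
      have h2 := commute_letter_of_mem_link hu' true
      rw [letter_true] at h1 h2
      rw [if_pos rfl, if_pos rfl, mul_assoc, h1.eq, mul_assoc, h2.eq, ← mul_assoc,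
        ← mul_assoc] at hh
      exact (mul_right_cancel hh).symm
  ext z
  rw [side, side, Set.mem_ofPred_eq, Set.mem_ofPred_eq, hk, mul_inv_rev, mul_assoc,
    wall_mul_left_of_mem_link (inv_mem (mul_mem hu (inv_mem hu')))]

/-- If `v` and `w` are not adjacent and some boundary vertex of a half-space `L` with label `w`
lies outside a half-space `H` with label `v`, then `H` is contained in `L` or disjoint from it. -/
theorem side_subset_side {k k' p q x : RAAG Γ} {v w : V} {ε δ : Bool} (hvw : ¬ Γ.Adj w v)
    (hpq : (cubeComplex Γ).skeleton.Adj p q) (hp : p ∈ side k' w δ) (hq : q ∉ side k' w δ)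
    (hpH : p ∉ side k v ε) (hx : x ∈ side k v ε) (hx' : x ∈ side k' w δ) :
    side k v ε ⊆ side k' w δ := by
  obtain ⟨_, _, rfl⟩ := adj_iff.1 hpq
  obtain ⟨-, -, u, hu, hpu⟩ := exists_of_mem_side_of_notMem hp hq
  -- A vertex of `H` on the boundary of `L` would differ from `p` by an element of `link Γ w`, which
  -- does not change `wall v`, so `p` would lie in `H`.
  have hb : ∀ y z, y ∈ side k v ε → (cubeComplex Γ).skeleton.Adj y z → y ∈ side k' w δ →
      z ∈ side k' w δ := by
    intro y z hy hyz hy'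
    by_contra hz
    obtain ⟨_, _, rfl⟩ := adj_iff.1 hyz
    obtain ⟨-, -, u', hu', hyu⟩ := exists_of_mem_side_of_notMem hy' hz
    apply hpH
    have : p = y * (u'⁻¹ * u) := by rw [hyu, hpu]; group
    rw [this, side, Set.mem_ofPred_eq, ← mul_assoc,
      wall_mul_of_mem_link hvw _ (mul_mem (inv_mem hu') hu)]
    exact hy
  intro z hz
  -- `H` is connected, so a walk inside it joins `x` to `z`; by `hb` it never leaves `L`.
  have hr := hx
  rw [side_eq_reachable] at hr
  have hr' := hz
  rw [side_eq_reachable] at hr'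
  obtain ⟨p⟩ := SimpleGraph.Reachable.trans (SimpleGraph.Reachable.symm hr) hr'
  clear hr hr'
  induction p with
  | nil => exact hx'
  | cons h p ih =>
    refine ih ?_ (hb _ _ hx (SimpleGraph.deleteEdges_adj.1 h).1 hx') hz
    have := wall_eq_of_adj_deleteEdges h
    rw [side, Set.mem_ofPred_eq] at hx ⊢
    rw [← this, hx]

/-- For non-adjacent labels, take a boundary vertex `p` of the second half-space. The side of the
first one not containing `p` does not meet the second hyperplane, so one of the four intersections
is empty. -/
theorem adj_of_transverse {k k' : RAAG Γ} {v w : V} {ε δ : Bool}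
    (h : Transverse (side k v ε) (side k' w δ)) : Γ.Adj v w := by
  by_contra hvw
  have hvw' : ¬ Γ.Adj w v := fun h => hvw h.symm
  obtain ⟨⟨a, ha, ha'⟩, ⟨b, hb, hb'⟩, ⟨c, hc, hc'⟩, ⟨d, hd, hd'⟩⟩ := h
  obtain ⟨p, hp, hq⟩ := exists_mem_side k' w δ
  rw [← side_not] at hc hd
  by_cases hpH : p ∈ side k v ε
  · have hpH' : p ∉ side k v (!ε) := by rw [side_not]; exact fun h => h hpH
    exact hd' (side_subset_side hvw' (adj_letter _ _ _) hp hq hpH' hc hc' hd)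
  · exact hb' (side_subset_side hvw' (adj_letter _ _ _) hp hq hpH ha ha' hb)

/-! ### Geodesics -/

theorem dist_mul_left_le (g x y : RAAG Γ) :
    (cubeComplex Γ).skeleton.dist (g * x) (g * y) ≤ (cubeComplex Γ).skeleton.dist x y := by
  let φ : (cubeComplex Γ).skeleton →g (cubeComplex Γ).skeleton :=
    ⟨fun x => g * x, fun {a b} h => by
      obtain ⟨v, ε, rfl⟩ := adj_iff.1 h
      exact adj_iff.2 ⟨v, ε, (mul_assoc _ _ _).symm⟩⟩
  obtain ⟨p, hp⟩ := (skeleton_connected Γ).exists_walk_length_eq_dist x y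
  rw [← hp, ← p.length_map φ]
  exact SimpleGraph.dist_le (p.map φ)

theorem dist_mul_mul (g x y : RAAG Γ) :
    (cubeComplex Γ).skeleton.dist (g * x) (g * y) = (cubeComplex Γ).skeleton.dist x y := by
  refine (dist_mul_left_le g x y).antisymm ?_
  simpa using dist_mul_left_le g⁻¹ (g * x) (g * y)

/-- The first `n` edges of the sequence `x` form a geodesic edge path. -/
structure IsGeodesic (x : ℕ → RAAG Γ) (n : ℕ) : Prop where
  adj : ∀ i < n, (cubeComplex Γ).skeleton.Adj (x i) (x (i + 1))
  dist : ∀ i j, i ≤ j → j ≤ n → (cubeComplex Γ).skeleton.dist (x i) (x j) = j - i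

theorem exists_isGeodesic (a b : RAAG Γ) : ∃ x : ℕ → RAAG Γ, x 0 = a ∧
    x ((cubeComplex Γ).skeleton.dist a b) = b ∧
    IsGeodesic x ((cubeComplex Γ).skeleton.dist a b) := by
  obtain ⟨p, hp⟩ := (skeleton_connected Γ).exists_walk_length_eq_dist a b
  rw [← hp]
  have hadj : ∀ i < p.length, (cubeComplex Γ).skeleton.Adj (p.getVert i) (p.getVert (i + 1)) :=
    fun i hi => p.adj_getVert_succ hi
  have hle : ∀ i j, i ≤ j → j ≤ p.length →
      (cubeComplex Γ).skeleton.dist (p.getVert i) (p.getVert j) ≤ j - i := by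
    intro i j hij
    induction j, hij using Nat.le_induction with
    | base => simp
    | succ j hij ih =>
      intro hj
      have h1 := ih (by omega)
      have h2 := (SimpleGraph.dist_eq_one_iff_adj).2 (hadj j hj)
      have h3 := (skeleton_connected Γ).dist_triangle (u := p.getVert i) (v := p.getVert j)
        (w := p.getVert (j + 1))
      omega
  refine ⟨p.getVert, p.getVert_zero, p.getVert_length, hadj, fun i j hij hj => ?_⟩
  -- The three upper bounds add up to the full distance, so the triangle inequality forces equality
  -- in each.
  have h1 := hle 0 i (by omega) (by omega)
  have h2 := hle i j hij hj
  have h3 := hle j _ hj le_rfl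
  rw [p.getVert_zero] at h1
  rw [p.getVert_length] at h3
  have h4 := (skeleton_connected Γ).dist_triangle (u := a) (v := p.getVert i) (w := b)
  have h5 := (skeleton_connected Γ).dist_triangle (u := p.getVert i) (v := p.getVert j) (w := b)
  omega

theorem IsGeodesic.reverse {x : ℕ → RAAG Γ} {n : ℕ} (h : IsGeodesic x n) :
    IsGeodesic (fun i => x (n - i)) n where
  adj i hi := by
    have := (h.adj (n - (i + 1)) (by omega)).symm
    rwa [show n - (i + 1) + 1 = n - i by omega] at this
  dist i j hij hj := by
    rw [SimpleGraph.dist_comm, h.dist _ _ (by omega) (by omega)]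
    omega

section Geodesic

variable {x : ℕ → RAAG Γ} {n : ℕ}

/-- A geodesic crosses a hyperplane at most once. If it came back, one translation would carry `x i`
to `x (i + 1)` and `x (j + 1)` to `x j`, equating two distances that differ by two. -/
theorem IsGeodesic.notMem_side (h : IsGeodesic x n) {k : RAAG Γ} {v : V} {ε : Bool} {i j : ℕ}
    (hi : x i ∈ side k v ε) (hi' : x (i + 1) ∉ side k v ε) (hij : i + 1 ≤ j) (hj : j ≤ n) :
    x j ∉ side k v ε := by
  induction j, hij using Nat.le_induction with
  | base => exact hi'
  | succ j hij ih =>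
    have hxj := ih (by omega)
    intro hxj'
    obtain ⟨_, _, h1⟩ := adj_iff.1 (h.adj i (by omega))
    obtain ⟨_, _, h2⟩ := adj_iff.1 (h.adj j (by omega)).symm
    rw [h1] at hi'
    rw [h2] at hxj
    obtain ⟨rfl, rfl, u, hu, e1⟩ := exists_of_mem_side_of_notMem hi hi'
    obtain ⟨rfl, rfl, u', hu', e2⟩ := exists_of_mem_side_of_notMem hxj' hxj
    generalize (if ε = true then k * gen Γ _ else k) = b at e1 e2
    rename_i w
    have c1 := commute_letter_of_mem_link hu (!ε)
    have c2 := commute_letter_of_mem_link hu' (!ε)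
    have e3 : x (i + 1) = b * letter Γ w (!ε) * b⁻¹ * x i := by
      rw [h1, e1, mul_assoc b, ← c1.eq]; group
    have e4 : x j = b * letter Γ w (!ε) * b⁻¹ * x (j + 1) := by
      rw [h2, e2, mul_assoc b, ← c2.eq]; group
    have d1 := h.dist (i + 1) j hij (by omega)
    have d2 := h.dist i (j + 1) (by omega) hj
    rw [e3, e4, dist_mul_mul] at d1
    omega

/-- Had the path entered the half-space at some earlier edge, it would have left the opposite one
there and could not be back in it at `i + 1`. -/
theorem IsGeodesic.mem_side (h : IsGeodesic x n) {k : RAAG Γ} {v : V} {ε : Bool} {i j : ℕ}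
    (hi : x i ∈ side k v ε) (hi' : x (i + 1) ∉ side k v ε) (hin : i < n) (hj : j ≤ i) :
    x j ∈ side k v ε := by
  induction hj using Nat.decreasingInduction with
  | self => exact hi
  | of_succ j hj ih =>
    by_contra hxj
    have h1 : x j ∈ side k v (!ε) := by rw [side_not]; exact hxj
    have h2 : x (j + 1) ∉ side k v (!ε) := by rw [side_not]; exact fun h => h ih
    have h3 := h.notMem_side h1 h2 (j := i + 1) (by omega) (by omega)
    rw [side_not] at h3
    exact h3 hi'

/-- If `x` is a shortest path from the half-space `H` to its last vertex, then the hyperplanes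
crossed by `x` are disjoint from `H`. -/
theorem IsGeodesic.side_subset (h : IsGeodesic x n) {k : RAAG Γ} {v : V} {ε : Bool}
    (h0 : x 0 ∈ side k v ε) (h1 : x 1 ∉ side k v ε)
    (hmin : ∀ y ∈ side k v ε, n ≤ (cubeComplex Γ).skeleton.dist y (x n)) (i : ℕ) (hi : i < n)
    (k' : RAAG Γ) (w : V) (δ : Bool) (hxi : x i ∈ side k' w δ) (hxi' : x (i + 1) ∉ side k' w δ) :
    side k v ε ⊆ side k' w δ := by
  induction i using Nat.strong_induction_on generalizing k' w δ with
  | _ i ih =>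
  rcases Nat.eq_zero_or_pos i with rfl | hpos
  · exact (side_eq_of_crossing (h.adj 0 hi) h0 h1 hxi hxi').subset
  -- If an earlier label is not adjacent to `w`, the half-space left at that edge contains `H` by
  -- induction and is contained in the present one.
  by_cases hcase : ∃ j < i, ∃ a θ, x (j + 1) = x j * letter Γ a θ ∧ ¬ Γ.Adj w a
  · obtain ⟨j, hj, a, θ, hxj, hadj⟩ := hcase
    obtain ⟨kj, hm, hm'⟩ := exists_side_of_letter (x j) a θ
    rw [← hxj] at hm'
    refine (ih j hj (by omega) kj a (!θ) hm hm').trans ?_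
    exact side_subset_side hadj (h.adj i hi) hxi hxi' (h.notMem_side hm hm' hj hi.le) hm
      (h.mem_side hxi hxi' hi hj.le)
  -- Otherwise the letter at `i` commutes with everything before it and can be moved to the front.
  -- Then `x 0 * letter Γ w θ` still lies in `H` and is at distance `i` from `x (i + 1)`, so it is
  -- closer to `x n` than `n`.
  · exfalso
    push Not at hcase
    obtain ⟨_, θ, hl⟩ := adj_iff.1 (h.adj i hi)
    obtain ⟨rfl, -, -⟩ := exists_of_mem_side_of_notMem hxi (hl ▸ hxi')
    rename_i w
    have hcomm : ∀ m ≤ i, Commute (letter Γ w θ) ((x 0)⁻¹ * x m) := by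
      intro m
      induction m with
      | zero => intro _; simp
      | succ m ihm =>
        intro hm
        obtain ⟨a, η, ha⟩ := adj_iff.1 (h.adj m (by omega))
        rw [ha, ← mul_assoc]
        exact (ihm (by omega)).mul_right (letter_commute (hcase m hm a η ha) _ _)
    have hmem : x 0 * letter Γ w θ ∈ side k v ε := by
      obtain ⟨a, η, ha⟩ := adj_iff.1 (h.adj 0 (by omega))
      have hwa := hcase 0 hpos a η ha
      rw [zero_add] at ha
      rw [ha] at h1
      obtain ⟨rfl, -, -⟩ := exists_of_mem_side_of_notMem h0 h1
      exact mul_letter_mem_side hwa.ne h0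
    have e1 : x 0 * letter Γ w θ = x 0 * letter Γ w θ * (x 0)⁻¹ * x 0 := by group
    have e2 : x (i + 1) = x 0 * letter Γ w θ * (x 0)⁻¹ * x i := by
      rw [hl, mul_assoc (x 0 * letter Γ w θ), mul_assoc (x 0), (hcomm i le_rfl).eq]; group
    have d1 : (cubeComplex Γ).skeleton.dist (x 0 * letter Γ w θ) (x (i + 1)) = i := by
      rw [e1, e2, dist_mul_mul, h.dist 0 i (by omega) (by omega), Nat.sub_zero]
    have d2 := h.dist (i + 1) n hi le_rfl
    have d3 := (skeleton_connected Γ).dist_triangle (u := x 0 * letter Γ w θ) (v := x (i + 1))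
      (w := x n)
    have d4 := hmin _ hmem
    omega

end Geodesic

/-! ### Osculation -/

/-- Take a shortest path from the smaller half-space to the complement of the larger. Length one
would make the half-spaces equal, and beyond length two its second hyperplane lies strictly between
them. -/
theorem exists_osculation {k k' : RAAG Γ} {v w : V} {ε δ : Bool}
    (hsub : side k v ε ⊆ side k' w δ) (hne : side k v ε ≠ side k' w δ)
    (htight : ¬ ∃ L, (cubeComplex Γ).IsHalfSpace L ∧ side k v ε ⊂ L ∧ L ⊂ side k' w δ) :
    ∃ p ∈ side k v ε, p * letter Γ v (!ε) ∉ side k v ε ∧ p * letter Γ v (!ε) ∈ side k' w δ ∧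
      p * letter Γ v (!ε) * letter Γ w (!δ) ∉ side k' w δ := by
  classical
  have hex : ∃ m, ∃ a ∈ side k v ε, ∃ b ∉ side k' w δ,
      (cubeComplex Γ).skeleton.dist a b = m := by
    obtain ⟨a, ha, -⟩ := exists_mem_side k v ε
    obtain ⟨b, -, hb⟩ := exists_mem_side k' w δ
    exact ⟨_, a, ha, _, hb, rfl⟩
  obtain ⟨a, ha, b, hb, hab⟩ := Nat.find_spec hex
  have hmin : ∀ a ∈ side k v ε, ∀ b ∉ side k' w δ,
      Nat.find hex ≤ (cubeComplex Γ).skeleton.dist a b :=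
    fun a ha b hb => Nat.find_min' hex ⟨a, ha, b, hb, rfl⟩
  obtain ⟨x, rfl, hxn, hx⟩ := exists_isGeodesic a b
  rw [hab] at hxn hx
  generalize Nat.find hex = n at *
  subst hxn
  have hn0 : n ≠ 0 := by
    rintro rfl
    exact hb (hsub ha)
  have h1 : x 1 ∉ side k v ε := by
    intro h
    have := hmin _ h _ hb
    rw [hx.dist 1 n (by omega) le_rfl] at this
    omega
  have hlt : ∀ i < n, x i ∈ side k' w δ := by
    intro i hi
    by_contra h
    have := hmin _ ha _ h
    rw [hx.dist 0 i (by omega) (by omega)] at this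
    omega
  have hn1 : n ≠ 1 := by
    rintro rfl
    exact hne (side_eq_of_crossing (hx.adj 0 (by omega)) ha h1 (hsub ha) hb)
  have hn2 : n = 2 := by
    by_contra hn2
    obtain ⟨c, θ, hc⟩ := adj_iff.1 (hx.adj 1 (by omega))
    obtain ⟨l, hl, hl'⟩ := exists_side_of_letter (x 1) c θ
    rw [← hc] at hl'
    have s1 := hx.side_subset ha h1 (fun y hy => hmin y hy _ hb) 1 (by omega) l c (!θ) hl hl'
    have hb' : x n ∈ side k' w (!δ) := by rw [side_not]; exact hb
    -- Along the reversed path, the edge from `x 2` to `x 1` has index `n - 2`. Taking complements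
    -- puts the half-space `side l c (!θ)` inside the larger one.
    have s2 := hx.reverse.side_subset (k := k') (v := w) (ε := !δ) (by simpa using hb')
      (by rw [side_not]; exact fun h => h (hlt (n - 1) (by omega)))
      (by
        intro y hy
        rw [side_not] at hy
        rw [Nat.sub_self, SimpleGraph.dist_comm]
        exact hmin _ ha _ hy) (n - 2) (by omega) l c θ
      (by
        rw [show n - (n - 2) = 2 by omega, ← Bool.not_not θ, side_not]
        exact hl')
      (by
        rw [show n - (n - 2 + 1) = 1 by omega, ← Bool.not_not θ, side_not]
        exact fun h => h hl)
    rw [← Bool.not_not θ, side_not _ _ (!θ), side_not, Set.compl_subset_compl] at s2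
    exact htight ⟨side l c (!θ), isHalfSpace_iff.2 ⟨_, _, _, rfl⟩,
      (Set.ssubset_iff_of_subset s1).2 ⟨x 1, hl, h1⟩,
      (Set.ssubset_iff_of_subset s2).2 ⟨x 2, hlt 2 (by omega), hl'⟩⟩
  subst hn2
  have hx1 := hlt 1 (by omega)
  obtain ⟨_, _, e1⟩ := adj_iff.1 (hx.adj 0 (by omega))
  obtain ⟨_, _, e2⟩ := adj_iff.1 (hx.adj 1 (by omega))
  rw [zero_add] at e1
  rw [e2] at hb
  obtain ⟨rfl, rfl, -⟩ := exists_of_mem_side_of_notMem hx1 hb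
  rw [e1] at hb hx1 h1
  obtain ⟨rfl, rfl, -⟩ := exists_of_mem_side_of_notMem ha h1
  exact ⟨x 0, ha, h1, hx1, hb⟩

/-- If the labels commuted, the osculating path could take the `w` edge first, staying in the
smaller half-space, and then the `v` edge, staying in the larger; but its end lies outside the
larger one. -/
theorem not_adj_of_tightlyNested {k k' : RAAG Γ} {v w : V} {ε δ : Bool}
    (hsub : side k v ε ⊆ side k' w δ) (hne : side k v ε ≠ side k' w δ)
    (htight : ¬ ∃ L, (cubeComplex Γ).IsHalfSpace L ∧ side k v ε ⊂ L ∧ L ⊂ side k' w δ) :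
    ¬ Γ.Adj v w := by
  intro hvw
  obtain ⟨p, hp, -, -, hr⟩ := exists_osculation hsub hne htight
  rw [mul_assoc, (letter_commute hvw _ _).eq, ← mul_assoc] at hr
  exact hr (mul_letter_mem_side hvw.ne (hsub (mul_letter_mem_side hvw.ne' hp)))

/-- With equal labels and opposite directions the second edge of the osculating path undoes the
first, so the path would end where it began. -/
theorem not_tightlyNested_of_opposite_sign {k k' : RAAG Γ} {v : V} {ε : Bool}
    (hsub : side k v ε ⊆ side k' v (!ε)) (hne : side k v ε ≠ side k' v (!ε)) :
    ∃ L, (cubeComplex Γ).IsHalfSpace L ∧ side k v ε ⊂ L ∧ L ⊂ side k' v (!ε) := by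
  by_contra htight
  obtain ⟨p, hp, -, -, hr⟩ := exists_osculation hsub hne htight
  rw [mul_letter_mul_letter_not] at hr
  exact hr (hsub hp)

theorem side_ne_side_not (k k' : RAAG Γ) (v : V) (ε : Bool) : side k' v ε ≠ side k v (!ε) := by
  intro h
  obtain ⟨p, hp, hq⟩ := exists_mem_side k' v ε
  rw [h] at hp hq
  simpa using (exists_of_mem_side_of_notMem hp hq).2.1

theorem smul_compl_side (g k : RAAG Γ) (v : V) (ε : Bool) :
    g • (side k v ε)ᶜ = side (g * k) v (!ε) := by
  rw [← side_not, smul_side]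

end RAAG

/-! ### The RAAG-like conditions -/

theorem mainTheorem9 {V : Type u} (Γ : SimpleGraph V) :
    (RAAG.cubeComplex Γ).IsRAAGLike (RAAG Γ) where
  cat0 := ⟨RAAG.isNonPositivelyCurved Γ, RAAG.isSimplyConnected Γ⟩
  automorphism g _ hC := RAAG.smul_cubes g hC
  without_inversion := by
    rintro ⟨H, g, hH, h⟩
    obtain ⟨k, v, ε, rfl⟩ := RAAG.isHalfSpace_iff.1 hH
    rw [RAAG.smul_side, ← RAAG.side_not] at h
    exact RAAG.side_ne_side_not _ _ _ _ h
  not_transverse := by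
    rintro ⟨H, g, hH, h⟩
    obtain ⟨k, v, ε, rfl⟩ := RAAG.isHalfSpace_iff.1 hH
    rw [RAAG.smul_side] at h
    exact (RAAG.adj_of_transverse h).ne rfl
  no_inter_osculation := by
    rintro ⟨H, H', g, hH, hH', ⟨hsub, htight⟩, h⟩
    obtain ⟨k, v, ε, rfl⟩ := RAAG.isHalfSpace_iff.1 hH
    obtain ⟨k', w, δ, rfl⟩ := RAAG.isHalfSpace_iff.1 hH'
    -- Tight nestedness admits equal half-spaces; that case is a self-transversality.
    by_cases hne : RAAG.side k v ε = RAAG.side k' w δ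
    · rw [← hne, RAAG.smul_side] at h
      exact (RAAG.adj_of_transverse h).ne rfl
    rw [RAAG.smul_side] at h
    have hadj := RAAG.adj_of_transverse h
    rcases hsub with hsub | hsub
    · exact RAAG.not_adj_of_tightlyNested hsub hne
        (fun ⟨L, hL, h⟩ => htight ⟨L, hL, .inl h⟩) hadj
    · exact RAAG.not_adj_of_tightlyNested hsub (Ne.symm hne)
        (fun ⟨L, hL, h⟩ => htight ⟨L, hL, .inr h⟩) hadj.symm
  no_self_osculation := by
    rintro ⟨H, g, hH, hsub, htight⟩
    obtain ⟨k, v, ε, rfl⟩ := RAAG.isHalfSpace_iff.1 hH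
    rw [RAAG.smul_compl_side] at hsub htight
    have hne := RAAG.side_ne_side_not (g * k) k v ε
    rcases hsub with hsub | hsub
    · obtain ⟨L, hL, h⟩ := RAAG.not_tightlyNested_of_opposite_sign hsub hne
      exact htight ⟨L, hL, .inl h⟩
    -- Writing the sign as a negation lets the same lemma apply with the two half-spaces exchanged.
    · obtain ⟨ε, rfl⟩ : ∃ δ, ε = !δ := ⟨!ε, by simp⟩
      rw [Bool.not_not] at hsub htight hne
      obtain ⟨L, hL, h⟩ := RAAG.not_tightlyNested_of_opposite_sign hsub hne.symm
      exact htight ⟨L, hL, .inr h⟩
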